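/- **Conventions.** A partition $\alpha=(\alpha_1\ge\alpha_2\ge\cdots)$ is drawn as a Young diagram with top-aligned columns of lengths $\alpha_1,\alpha_2,\dots$; rows are numbered from the top, $\overline{\alpha}$ is the transposed partition (so $\overline\alpha_i$ is the length of row $i$) and $|\alpha|$ is the weight. For partitions $\mu,\nu$ (of possibly different weights) write $\mu\le_{\rm nat}\nu$ if $\sum_{i\le c}\overline{\mu}_i\le\sum_{i\le c}\overline{\nu}_i$ for all $c$. For $\gamma\subseteq\beta$, the skew diagram $\beta\setminus\gamma$ is a *rook strip* if $\beta_i\le\gamma_i+1$ and $\overline\beta_i\le\overline\gamma_i+1$ for all $i$. **Tableaux.** An *LR-tableau* of shape $\beta\setminus\gamma$ and content $\alpha$ is a filling of $\beta\setminus\gamma$ with $\overline\alpha_1$ entries $1$, $\overline\alpha_2$ entries $2$, etc., weakly increasing along rows, strictly increasing down columns, and such that for all $j$ and $e\ge1$ the columns with number $\ge j$ contain at least as many entries $e$ as entries $e+1$. Let $\mathcal T_{r,\gamma}^\beta$ be the set of LR-tableaux of shape $\beta\setminus\gamma$ whose content $\alpha$ satisfies $|\alpha|=r$. For $\Gamma\in\mathcal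 T_{r,\gamma}^\beta$ let $\gamma^{(e)}$ be the partition whose diagram consists of $\gamma$ and the boxes of $\beta\setminus\gamma$ with entry at most $e$; write $\Gamma=[\gamma^{(0)},\gamma^{(1)},\dots]$. **Combinatorial orders** on $\mathcal T_{r,\gamma}^\beta$. The *box order* $\le_{\rm box}$ is the reflexive and transitive closure of the relation $\prec_{\rm box}$, where $\Delta\prec_{\rm box}\Gamma$ if $\Delta$ is obtained from $\Gamma$ by swapping two different entries so that the smaller one winds up in the lower row, or by increasing one entry. The *dominance order* is given by $\Delta\le_{\rm dom}\Gamma$ if $\delta^{(i)}\le_{\rm nat}\gamma^{(i)}$ for $0\le i\le r$. **Algebraic orders.** Let $k$ be a field and $\Lambda=k[p]$. Let $\mathcal S$ be the category of embeddings $(A\subseteq B)$, where $B$ is a finite dimensional $\Lambda$-module on which $p$ acts nilpotently and $A$ is a submodule; morphisms $(A\subseteq B)\to(A'\subseteq B')$ are the $\Lambda$-linear maps $f:B\to B'$ with $f(A)\subseteq A'$, and a sequence $0\to U\to H\to V\to0$ in $\mathcal S$ is exact if it is exact on both the submodules and the ambient modules. Put $N_\alpha=\bigoplus_i\Lambda/(p^{\alpha_i})$,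 and let $\mathcal S_{r,\gamma}^\beta$ consist of the embeddings $(A\subseteq B)$ with $B\cong N_\beta$, $B/A\cong N_\gamma$ and $A\cong N_\alpha$ for some $\alpha$ with $|\alpha|=r$. Write $LR(A\subseteq B)=\Gamma$ if $B/p^eA\cong N_{\gamma^{(e)}}$ for all $e\ge0$. For $X,Y\in\mathcal S_{r,\gamma}^\beta$ write $X\le_{\rm ext}Y$ if there are an integer $s\ge 0$ and exact sequences $0\to U_i\to H_i\to V_i\to0$ in $\mathcal S$ ($1\le i\le s$) with $X\cong H_1$, $U_i\oplus V_i\cong H_{i+1}$ for $1\le i\le s$ and $Y\cong H_{s+1}$; write $X\le_{\rm hom}Y$ if $\dim_k\mathrm{Hom}_{\mathcal S}(X,Z)\le\dim_k\mathrm{Hom}_{\mathcal S}(Y,Z)$ for every $Z\in\mathcal S$. For $\Delta,\Gamma\in\mathcal T_{r,\gamma}^\beta$ write $\Delta\le_{\rm ext}\Gamma$ (resp. $\Delta\le_{\rm hom}\Gamma$) if there is a finite sequence $\Delta=\Gamma^{(0)},\Gamma^{(1)},\dots,\Gamma^{(s)}=\Gamma$ in $\mathcal T_{r,\gamma}^\beta$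 such that for each $1\le i\le s$ there are $X,Y\in\mathcal S_{r,\gamma}^\beta$ with $LR(X)=\Gamma^{(i-1)}$, $LR(Y)=\Gamma^{(i)}$ and $X\le_{\rm ext}Y$ (resp. $X\le_{\rm hom}Y$). **Theorem.** Let $k$ be any field, $r\ge1$ an integer, and $\beta,\gamma$ partitions such that $\beta\setminus\gamma$ is a rook strip and $|\beta|-|\gamma|=r$. Then the four relations $\le_{\rm box}$, $\le_{\rm ext}$, $\le_{\rm hom}$ and $\le_{\rm dom}$ on $\mathcal T_{r,\gamma}^\beta$ coincide. -/

import Mathlib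

universe u

/-!
Conventions.  A partition `α = (α₁ ≥ α₂ ≥ …)` is represented by the Young diagram whose `j`-th
*column* (counted from `0`) has `α_{j+1}` cells.  With Mathlib's `YoungDiagram` (cells `(i, j)`,
`i` = row counted from the top, `j` = column) this reads `α_{j+1} = α.colLen j`; the parts of the
transposed partition are the row lengths `α.rowLen i`, and the weight is `α.card`.
-/

namespace LRInv

/-! ### Partitions and strips -/

/-- The natural order on partitions (of possibly different weights): `μ ≤ ν` iff
`∑_{i ≤ c} μ̄ᵢ ≤ ∑_{i ≤ c} ν̄ᵢ` for all `c`, where the bar denotes the transposed partition. -/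
def NatLE (μ ν : YoungDiagram) : Prop :=
  ∀ c : ℕ, ∑ i ∈ Finset.range c, μ.rowLen i ≤ ∑ i ∈ Finset.range c, ν.rowLen i

/-- `β ∖ γ` is a horizontal strip: `γ ⊆ β` and `βⱼ ≤ γⱼ + 1` for all `j`. -/
def IsHorizontalStrip (β γ : YoungDiagram) : Prop :=
  γ ≤ β ∧ ∀ j : ℕ, β.colLen j ≤ γ.colLen j + 1

/-- `β ∖ γ` is a vertical strip: the transposed skew diagram is a horizontal strip. -/
def IsVerticalStrip (β γ : YoungDiagram) : Prop :=
  IsHorizontalStrip β.transpose γ.transpose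

/-- `β ∖ γ` is a rook strip: both a horizontal and a vertical strip. -/
def IsRookStrip (β γ : YoungDiagram) : Prop :=
  IsHorizontalStrip β γ ∧ IsVerticalStrip β γ

/-! ### Littlewood-Richardson tableaux -/

/-- `t` is an LR-tableau of shape `β ∖ γ` and content `α`.  A filling of `β ∖ γ` is encoded as a
function on all positions `(row, column)` which is `0` exactly off `β ∖ γ`. -/
structure IsLRTableau (α β γ : YoungDiagram) (t : ℕ × ℕ → ℕ) : Prop where
  sub : γ ≤ β
  eq_zero : ∀ c, c ∉ β.cells \ γ.cells → t c = 0
  pos : ∀ c ∈ β.cells \ γ.cells, 1 ≤ t c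
  /-- the entry `e + 1` occurs `ᾱ_{e+1}` times -/
  content : ∀ e : ℕ, ((β.cells \ γ.cells).filter fun c => t c = e + 1).card = α.rowLen e
  /-- entries weakly increase along rows -/
  row_weak : ∀ i j j' : ℕ, j < j' → (i, j) ∈ β.cells \ γ.cells → (i, j') ∈ β.cells \ γ.cells →
    t (i, j) ≤ t (i, j')
  /-- entries strictly increase down columns -/
  col_strict : ∀ i i' j : ℕ, i < i' → (i, j) ∈ β.cells \ γ.cells → (i', j) ∈ β.cells \ γ.cells →
    t (i, j) < t (i', j)
  /-- lattice permutation property: among the columns with index at least `j` there are at least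
  as many entries `e + 1` as entries `e + 2` -/
  lattice : ∀ j e : ℕ,
    ((β.cells \ γ.cells).filter fun c => j ≤ c.2 ∧ t c = e + 2).card ≤
      ((β.cells \ γ.cells).filter fun c => j ≤ c.2 ∧ t c = e + 1).card

/-- The set of all LR-tableaux of shape `β ∖ γ` whose content is a partition of weight `r`. -/
def LRTableaux (r : ℕ) (β γ : YoungDiagram) : Set (ℕ × ℕ → ℕ) :=
  {t | ∃ α : YoungDiagram, α.card = r ∧ IsLRTableau α β γ t}

variable {r : ℕ} {β γ : YoungDiagram}

/-- The partition `γ⁽ᵉ⁾` of a tableau `Γ = [γ⁽⁰⁾, γ⁽¹⁾, …]`: all cells of `γ`, together with the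
cells of `β ∖ γ` whose entry is at most `e`. -/
def level (Γ : LRTableaux r β γ) (e : ℕ) : YoungDiagram where
  cells := β.cells.filter fun c => Γ.1 c ≤ e
  isLowerSet := by
    obtain ⟨t, α, -, h⟩ := Γ
    rintro ⟨i', j'⟩ ⟨i, j⟩ hle hmem
    obtain ⟨hi, hj⟩ : i ≤ i' ∧ j ≤ j' := hle
    simp only [Finset.coe_filter, Set.mem_ofPred_eq, YoungDiagram.mem_cells] at hmem ⊢
    obtain ⟨hβ, hte⟩ := hmem
    have hβ1 : (i, j) ∈ β := β.up_left_mem hi hj hβ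
    have hβ2 : (i', j) ∈ β := β.up_left_mem le_rfl hj hβ
    refine ⟨hβ1, ?_⟩
    by_cases hγ : (i, j) ∈ γ
    · rw [h.eq_zero (i, j) (by simp [hγ])]
      exact Nat.zero_le _
    · have hγ2 : (i', j) ∉ γ := fun hc => hγ (γ.up_left_mem hi le_rfl hc)
      have hγ3 : (i', j') ∉ γ := fun hc => hγ (γ.up_left_mem hi hj hc)
      have h1 : t (i, j) ≤ t (i', j) := by
        rcases hi.eq_or_lt with rfl | hlt
        · exact le_rfl
        · exact (h.col_strict i i' j hlt (by simp [hγ, hβ1]) (by simp [hγ2, hβ2])).le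
      have h2 : t (i', j) ≤ t (i', j') := by
        rcases hj.eq_or_lt with rfl | hlt
        · exact le_rfl
        · exact h.row_weak i' j j' hlt (by simp [hγ2, hβ2]) (by simp [hγ3, hβ])
      exact h1.trans (h2.trans hte)

/-! ### The two combinatorial orders -/

/-- `Δ ≺_box Γ`: `Δ` is obtained from `Γ` by a decreasing box move, that is, either by swapping two
entries so that the smaller one winds up in the lower position (here: the smaller entry of `Γ` is
in the cell `c`, the larger one in the cell `d` which lies in a lower row), or by increasing
one entry. -/
def BoxMove (Δ Γ : LRTableaux r β γ) : Prop :=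
  (∃ c ∈ β.cells \ γ.cells, ∃ d ∈ β.cells \ γ.cells,
      c.1 < d.1 ∧ Γ.1 c < Γ.1 d ∧ Δ.1 = Γ.1 ∘ Equiv.swap c d) ∨
    (∃ c ∈ β.cells \ γ.cells, ∃ m : ℕ, Γ.1 c < m ∧ Δ.1 = Function.update Γ.1 c m)

/-- The box order: the reflexive and transitive closure of `≺_box`. -/
def BoxLE (Δ Γ : LRTableaux r β γ) : Prop :=
  Relation.ReflTransGen BoxMove Δ Γ

/-- The dominance order. -/
def DomLE (Δ Γ : LRTableaux r β γ) : Prop :=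
  ∀ i ≤ r, NatLE (level Δ i) (level Γ i)

/-! ### Invariant subspaces of nilpotent linear operators -/

open Polynomial
open scoped Pointwise

/-- An embedding `(A ⊆ B)`: a finite dimensional `k[X]`-module `B` on which `X` acts nilpotently,
with a submodule `A`. -/
structure Embedding (k : Type u) [Field k] where
  B : Type u
  [addCommGroup : AddCommGroup B]
  [moduleK : Module k B]
  [modulePoly : Module k[X] B]
  [tower : IsScalarTower k k[X] B]
  [finite : FiniteDimensional k B]
  nilpotent : ∃ n : ℕ, ∀ b : B, (X ^ n : k[X]) • b = 0
  A : Submodule k[X] B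

attribute [instance] Embedding.addCommGroup Embedding.moduleK Embedding.modulePoly
  Embedding.tower Embedding.finite

variable {k : Type u} [Field k]

/-- The module `N_α = k[X]/(X^{α₁}) ⊕ k[X]/(X^{α₂}) ⊕ ⋯`. -/
abbrev NilpModule (k : Type u) [Field k] (α : YoungDiagram) : Type u :=
  ∀ j : Fin (α.rowLen 0), k[X] ⧸ Ideal.span {(X ^ α.colLen j : k[X])}

/-- The `k`-space `Hom_S(Y, Z)` of morphisms `(A ⊆ B) → (A' ⊆ B')`: the `k[X]`-linear maps
`f : B → B'` with `f(A) ⊆ A'`. -/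
noncomputable def Hom (Y Z : Embedding k) : Submodule k (Y.B →ₗ[k[X]] Z.B) where
  carrier := {f | ∀ a ∈ Y.A, f a ∈ Z.A}
  add_mem' hf hg a ha := Z.A.add_mem (hf a ha) (hg a ha)
  zero_mem' _ _ := Z.A.zero_mem
  smul_mem' c f hf a ha := by
    rw [LinearMap.smul_apply, ← algebraMap_smul k[X] c (f a)]
    exact Z.A.smul_mem _ (hf a ha)

/-- Isomorphism of embeddings. -/
def Iso (Y Z : Embedding k) : Prop :=
  ∃ f : Y.B ≃ₗ[k[X]] Z.B, ∀ b : Y.B, b ∈ Y.A ↔ f b ∈ Z.A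

/-- The direct sum of two embeddings. -/
noncomputable def Embedding.directSum (Y Z : Embedding k) : Embedding k where
  B := Y.B × Z.B
  nilpotent := by
    obtain ⟨m, hm⟩ := Y.nilpotent
    obtain ⟨n, hn⟩ := Z.nilpotent
    refine ⟨m + n, fun b => Prod.ext ?_ ?_⟩
    · change (X ^ (m + n) : k[X]) • b.1 = 0
      rw [pow_add, mul_comm, mul_smul, hm, smul_zero]
    · change (X ^ (m + n) : k[X]) • b.2 = 0
      rw [pow_add, mul_smul, hn, smul_zero]
  A := Y.A.prod Z.A

/-- There is a short exact sequence `0 → U → H → V → 0` of embeddings, that is, morphisms `f`, `g`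
such that both `0 → B_U → B_H → B_V → 0` and the restriction `0 → A_U → A_H → A_V → 0` are exact
(injectivity of `A_U → A_H` and `g ∘ f = 0` on `A_U` are inherited). -/
def ShortExact (U H V : Embedding k) : Prop :=
  ∃ f ∈ Hom U H, ∃ g ∈ Hom H V,
    Function.Injective f ∧ Function.Exact f g ∧ Function.Surjective g ∧
    (∀ a ∈ H.A, g a = 0 → ∃ a' ∈ U.A, f a' = a) ∧
    (∀ a'' ∈ V.A, ∃ a ∈ H.A, g a = a'')

/-- The relation `Y ≤_ext Z` for embeddings. -/
def Embedding.ExtLE (Y Z : Embedding k) : Prop :=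
  ∃ (s : ℕ) (H U V : ℕ → Embedding k),
    Iso Y (H 0) ∧
    (∀ i < s, ShortExact (U i) (H i) (V i) ∧ Iso ((U i).directSum (V i)) (H (i + 1))) ∧
    Iso Z (H s)

/-- The relation `Y ≤_hom Z` for embeddings: `dim Hom(Y, W) ≤ dim Hom(Z, W)` for every `W`. -/
def Embedding.HomLE (Y Z : Embedding k) : Prop :=
  ∀ W : Embedding k, Module.finrank k (Hom Y W) ≤ Module.finrank k (Hom Z W)

/-- `Y` lies in `S_{r,γ}^β`: `B ≅ N_β`, `B/A ≅ N_γ` and `A ≅ N_α` for a partition `α` of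
weight `r`. -/
def InCategory (r : ℕ) (β γ : YoungDiagram) (Y : Embedding k) : Prop :=
  Nonempty (Y.B ≃ₗ[k[X]] NilpModule k β) ∧
  Nonempty ((Y.B ⧸ Y.A) ≃ₗ[k[X]] NilpModule k γ) ∧
  ∃ α : YoungDiagram, α.card = r ∧ Nonempty (Y.A ≃ₗ[k[X]] NilpModule k α)

/-- `LR(Y) = Γ`, where `Γ = [γ⁽⁰⁾, γ⁽¹⁾, …]`: one has `B / X^e A ≅ N_{γ⁽ᵉ⁾}` for all `e`. -/
def HasTableau (Y : Embedding k) (Γ : LRTableaux r β γ) : Prop :=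
  ∀ e : ℕ, Nonempty ((Y.B ⧸ ((X ^ e : k[X]) • Y.A)) ≃ₗ[k[X]] NilpModule k (level Γ e))

/-! ### The two algebraic orders on LR-tableaux -/

variable (k)

/-- The ext order on LR-tableaux: chains of tableaux in which consecutive ones are the tableaux of
embeddings `Y`, `Z` in `S_{r,γ}^β` with `Y ≤_ext Z`. -/
def ExtLE (Δ Γ : LRTableaux r β γ) : Prop :=
  Relation.ReflTransGen
    (fun Δ' Γ' : LRTableaux r β γ => ∃ Y Z : Embedding k,
      InCategory r β γ Y ∧ InCategory r β γ Z ∧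
      HasTableau Y Δ' ∧ HasTableau Z Γ' ∧ Y.ExtLE Z) Δ Γ

/-- The hom order on LR-tableaux: chains of tableaux in which consecutive ones are the tableaux of
embeddings `Y`, `Z` in `S_{r,γ}^β` with `Y ≤_hom Z`. -/
def HomLE (Δ Γ : LRTableaux r β γ) : Prop :=
  Relation.ReflTransGen
    (fun Δ' Γ' : LRTableaux r β γ => ∃ Y Z : Embedding k,
      InCategory r β γ Y ∧ InCategory r β γ Z ∧
      HasTableau Y Δ' ∧ HasTableau Z Γ' ∧ Y.HomLE Z) Δ Γ

end LRInv

namespace LRInv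

/-! ### Lattice words -/

/-! In a rook strip every row and every column contains at most one cell, and lower cells lie
further to the left. A tableau is therefore the word of its entries read from top to bottom, with
blanks in the rows that miss the strip. The row and column conditions become empty, and the LR
condition says that this word is a lattice word. Dominance compares, for all `e` and `n`, the number
of nonzero letters at most `e` among the first `n` letters (`domLE_iff`).

Three implications are direct. A box move to a smaller tableau lowers these counts, so box implies
dominance. `Hom(-, W)` is left exact, so ext implies hom. The partial sums of the row lengths of
`γ⁽ᵉ⁾` are dimensions of Hom spaces into cyclic modules with submodule `ker X ^ e`, so hom implies
dominance.

The way back is a single kind of move. If `V` is strictly dominated by `W`, then a letter `W p` can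
be raised to some `b`, while the next `b` (if any) drops to `W p`, so that the result is still a
lattice word dominating `V` (`exists_lowering`). Iteration connects any two comparable tableaux.
Each move is visibly a box move; it remains to realise it by an extension.

In a lattice word the `q`-th letters `1, 2, 3, …` occur in this order and form the `q`-th chain. Let
`Eᵢ` generate the summand of `N_β` whose column ends in strip row `i`; it has order `X ^ (i + 1)`.
The sums of `X ^ (i + 1 - W i) • Eᵢ` over the chains generate a submodule with tableau `Γ`
(`realizes_chainGen`). Adding `X ^ (p + 1 - b) • E_p` to the generator of the chain that `p` joins
as a letter `b` changes the tableau to the lowered one (`realizes_lowerGen`). The projection to the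
columns of that chain kills the added term, so the deformed embedding is an extension whose split
form is the original one (`LowerMove.exists_extLE`). -/

/-- The number of letters `e` among the first `n` letters of `W`. -/
def letterCount (W : ℕ → ℕ) (e n : ℕ) : ℕ := Nat.count (fun i => W i = e) n

/-- The number of nonzero letters at most `e` among the first `n` letters of `W`. -/
def cumCount (W : ℕ → ℕ) (e n : ℕ) : ℕ := Nat.count (fun i => 1 ≤ W i ∧ W i ≤ e) n

/-- `W` is a lattice word; the letter `0` is a blank. -/
def IsLattice (W : ℕ → ℕ) : Prop :=
  ∀ n e : ℕ, 1 ≤ e → letterCount W (e + 1) n ≤ letterCount W e n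

theorem letterCount_zero (W : ℕ → ℕ) (e : ℕ) : letterCount W e 0 = 0 := by simp [letterCount]

theorem letterCount_succ (W : ℕ → ℕ) (e n : ℕ) :
    letterCount W e (n + 1) = letterCount W e n + if W n = e then 1 else 0 := by
  simp [letterCount, Nat.count_succ]

theorem letterCount_mono (W : ℕ → ℕ) (e : ℕ) {m n : ℕ} (h : m ≤ n) :
    letterCount W e m ≤ letterCount W e n := Nat.count_monotone _ h

theorem cumCount_zero (W : ℕ → ℕ) (e : ℕ) : cumCount W e 0 = 0 := by simp [cumCount]

theorem cumCount_succ (W : ℕ → ℕ) (e n : ℕ) :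
    cumCount W e (n + 1) = cumCount W e n + if 1 ≤ W n ∧ W n ≤ e then 1 else 0 := by
  simp [cumCount, Nat.count_succ]

theorem letterCount_congr {W V : ℕ → ℕ} (e : ℕ) {n : ℕ} (h : ∀ i < n, W i = V i) :
    letterCount W e n = letterCount V e n := by
  induction n with
  | zero => simp [letterCount_zero]
  | succ n ih =>
    rw [letterCount_succ, letterCount_succ, ih fun i hi => h i (by omega), h n (by omega)]

theorem cumCount_congr {W V : ℕ → ℕ} (e : ℕ) {n : ℕ} (h : ∀ i < n, W i = V i) :
    cumCount W e n = cumCount V e n := by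
  induction n with
  | zero => simp [cumCount_zero]
  | succ n ih =>
    rw [cumCount_succ, cumCount_succ, ih fun i hi => h i (by omega), h n (by omega)]

theorem cumCount_add_sum (W : ℕ → ℕ) {e b : ℕ} (h : e ≤ b) (n : ℕ) :
    cumCount W b n = cumCount W e n + ∑ f ∈ Finset.Ioc e b, letterCount W f n := by
  induction n with
  | zero => simp [cumCount_zero, letterCount_zero]
  | succ n ih =>
    simp only [cumCount_succ, letterCount_succ, Finset.sum_add_distrib, ih]
    have : (∑ f ∈ Finset.Ioc e b, if W n = f then 1 else 0) =
        if e < W n ∧ W n ≤ b then 1 else 0 := by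
      simp [Finset.mem_Ioc]
    rw [this]
    split_ifs <;> omega

theorem exists_of_lt_letterCount {W : ℕ → ℕ} {e q n : ℕ} (h : q < letterCount W e n) :
    ∃ i < n, W i = e ∧ letterCount W e i = q := by
  induction n with
  | zero => simp [letterCount_zero] at h
  | succ n ih =>
    by_cases h' : q < letterCount W e n
    · obtain ⟨i, hi, hi'⟩ := ih h'
      exact ⟨i, by omega, hi'⟩
    · rw [letterCount_succ] at h
      split_ifs at h with hW
      · exact ⟨n, by omega, hW, by omega⟩
      · omega

theorem letterCount_lt {W : ℕ → ℕ} {e i n : ℕ} (hi : W i = e) (h : i < n) :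
    letterCount W e i < letterCount W e n := by
  have h1 := letterCount_mono W e (show i + 1 ≤ n from h)
  rw [letterCount_succ, if_pos hi] at h1
  omega

/-- The number of earlier letters equal to the letter in position `i`. -/
def colIndex (W : ℕ → ℕ) (i : ℕ) : ℕ := letterCount W (W i) i

theorem eq_of_colIndex_eq {W : ℕ → ℕ} {i i' : ℕ} (h : W i = W i')
    (hc : colIndex W i = colIndex W i') : i = i' := by
  unfold colIndex at hc
  rcases lt_trichotomy i i' with h1 | h1 | h1
  · have := letterCount_lt h h1
    rw [← h] at hc this; omega
  · exact h1
  · have := letterCount_lt h.symm h1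
    rw [h] at hc this; omega

/-- Letters with equal `colIndex` form a chain: the lattice condition, applied just after the `q`-th
letter `e + 1`, forces the `q`-th letter `e` to stand before it. -/
theorem IsLattice.exists_pred {W : ℕ → ℕ} (hW : IsLattice W) {i e : ℕ} (he : 1 ≤ e)
    (hi : W i = e + 1) : ∃ i' < i, W i' = e ∧ colIndex W i' = colIndex W i := by
  have h1 := hW (i + 1) e he
  rw [letterCount_succ, letterCount_succ, if_pos hi, if_neg (by omega)] at h1
  obtain ⟨i', h, h', h''⟩ := exists_of_lt_letterCount
    (show letterCount W (e + 1) i < letterCount W e i by omega)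
  exact ⟨i', h, h', by rw [colIndex, colIndex, h', h'', hi]⟩

theorem IsLattice.exists_above {W : ℕ → ℕ} (hW : IsLattice W) {l : ℕ} (hl : 1 ≤ l) (d : ℕ) :
    ∀ i, W i = l + d → ∃ i', i' + d ≤ i ∧ W i' = l ∧ colIndex W i' = colIndex W i := by
  induction d with
  | zero => exact fun i hi => ⟨i, le_rfl, hi, rfl⟩
  | succ d ih =>
    intro i hi
    obtain ⟨i', h, h', h''⟩ := hW.exists_pred (e := l + d) (by omega) hi
    obtain ⟨i₀, h₀, h₀', h₀''⟩ := ih i' h'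
    exact ⟨i₀, by omega, h₀', h₀''.trans h''⟩

theorem IsLattice.add_sub_le {W : ℕ → ℕ} (hW : IsLattice W) {i i' : ℕ} (hi : 1 ≤ W i)
    (hii : W i ≤ W i') (hc : colIndex W i = colIndex W i') : i + (W i' - W i) ≤ i' := by
  obtain ⟨i₀, h₀, h₀', h₀''⟩ := hW.exists_above hi (W i' - W i) i' (by omega)
  have := eq_of_colIndex_eq h₀' (h₀''.trans hc.symm)
  omega

theorem IsLattice.le_succ {W : ℕ → ℕ} (hW : IsLattice W) (i : ℕ) : W i ≤ i + 1 := by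
  by_contra! h
  obtain ⟨i₀, h₀, -⟩ := hW.exists_above le_rfl (W i - 1) i (by omega)
  omega

theorem IsLattice.letterCount_anti {W : ℕ → ℕ} (hW : IsLattice W) {e f : ℕ} (he : 1 ≤ e)
    (hef : e ≤ f) (n : ℕ) : letterCount W f n ≤ letterCount W e n := by
  induction f, hef using Nat.le_induction with
  | base => exact le_rfl
  | succ f hf ih => exact (hW n f (by omega)).trans ih

/-! ### Lowering moves -/

/-- `i` is the position of the first letter `b` after the position `p`. -/
def IsNext (W : ℕ → ℕ) (p b i : ℕ) : Prop :=
  p < i ∧ W i = b ∧ letterCount W b i = letterCount W b p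

open Classical in
/-- Raise the letter in position `p` to `b`, and replace the first letter `b` after `p`
(if there is one) by the old letter in position `p`. -/
noncomputable def lower (W : ℕ → ℕ) (p b : ℕ) (i : ℕ) : ℕ :=
  if i = p then b else if IsNext W p b i then W p else W i

theorem IsNext.unique {W : ℕ → ℕ} {p b i i' : ℕ} (h : IsNext W p b i) (h' : IsNext W p b i') :
    i = i' :=
  eq_of_colIndex_eq (h.2.1.trans h'.2.1.symm) (by
    rw [colIndex, colIndex, h.2.1, h'.2.1, h.2.2, h'.2.2])

theorem lower_self (W : ℕ → ℕ) (p b : ℕ) : lower W p b p = b := by simp [lower]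

theorem lower_next {W : ℕ → ℕ} {p b j : ℕ} (h : IsNext W p b j) : lower W p b j = W p := by
  simp [lower, h, h.1.ne']

theorem lower_of_ne {W : ℕ → ℕ} {p b i : ℕ} (h : i ≠ p) (h' : ¬ IsNext W p b i) :
    lower W p b i = W i := by
  simp [lower, h, h']

/-- The condition `p < n ∧ letterCount W b n = letterCount W b p` describes the window from `p` to
the next `b`: a prefix of such a length sees the raised letter but not its compensation. All other
prefixes keep their letter counts. -/
theorem count_lower (W : ℕ → ℕ) (p b : ℕ) (hb : W p ≠ b) (P : ℕ → Prop) [DecidablePred P]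
    (n : ℕ) :
    Nat.count (fun i => P (lower W p b i)) n +
        (if p < n ∧ letterCount W b n = letterCount W b p ∧ P (W p) then 1 else 0) =
      Nat.count (fun i => P (W i)) n +
        (if p < n ∧ letterCount W b n = letterCount W b p ∧ P b then 1 else 0) := by
  induction n with
  | zero => simp
  | succ n ih =>
    rw [Nat.count_succ, Nat.count_succ]
    rcases lt_trichotomy n p with h | h | h
    · rw [lower_of_ne h.ne fun hn => by have := hn.1; omega]
      have h1 : ¬ p < n := by omega
      have h2 : ¬ p < n + 1 := by omega
      simp only [h1, h2, false_and, if_false] at ih ⊢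
      omega
    · subst h
      have h1 : letterCount W b (n + 1) = letterCount W b n := by
        simp [letterCount_succ, hb]
      rw [lower_self, h1]
      simp only [lt_irrefl, false_and, if_false, add_zero] at ih
      simp only [lt_add_one, true_and, ih]
      omega
    · have h2 : p < n + 1 := by omega
      have hm := letterCount_mono W b h.le
      by_cases hn : IsNext W p b n
      · rw [lower_next hn]
        have h3 : letterCount W b (n + 1) ≠ letterCount W b p := by
          rw [letterCount_succ, if_pos hn.2.1, hn.2.2]; omega
        simp only [h, h2, hn.2.2, h3, hn.2.1, true_and, false_and, if_false] at ih ⊢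
        omega
      · rw [lower_of_ne h.ne' hn]
        have h3 : letterCount W b (n + 1) = letterCount W b p ↔
            letterCount W b n = letterCount W b p := by
          rw [letterCount_succ]
          split_ifs with hWn
          · constructor
            · omega
            · exact fun h' => absurd ⟨h, hWn, h'⟩ hn
          · simp
        simp only [h, h2, h3, true_and] at ih ⊢
        omega

theorem letterCount_lower (W : ℕ → ℕ) {p b : ℕ} (hb : W p ≠ b) (e n : ℕ) :
    letterCount (lower W p b) e n +
        (if p < n ∧ letterCount W b n = letterCount W b p ∧ W p = e then 1 else 0) =
      letterCount W e n +
        (if p < n ∧ letterCount W b n = letterCount W b p ∧ b = e then 1 else 0) :=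
  count_lower W p b hb (fun x => x = e) n

theorem cumCount_lower (W : ℕ → ℕ) {p b : ℕ} (hp : 1 ≤ W p) (hb : W p < b) (e n : ℕ) :
    cumCount (lower W p b) e n +
        (if p < n ∧ letterCount W b n = letterCount W b p ∧ W p ≤ e ∧ e < b then 1 else 0) =
      cumCount W e n := by
  have := count_lower W p b hb.ne (fun x => 1 ≤ x ∧ x ≤ e) n
  unfold cumCount
  by_cases h : p < n ∧ letterCount W b n = letterCount W b p
  · simp only [h.1, h.2, true_and] at this ⊢
    split_ifs at this ⊢ <;> omega
  · have h1 : ∀ Q : Prop, ¬ (p < n ∧ letterCount W b n = letterCount W b p ∧ Q) :=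
      fun Q hQ => h ⟨hQ.1, hQ.2.1⟩
    simpa only [h1, if_false, add_zero] using this

/-- A move from `W` to `lower W p b` in which no letter between the old and the new value of the
position `p` occurs before the next letter `b`. -/
structure IsLowering (W : ℕ → ℕ) (p b : ℕ) : Prop where
  pos : 1 ≤ W p
  lt : W p < b
  gap : ∀ i, p < i → letterCount W b i = letterCount W b p → W i < W p ∨ b ≤ W i
  lattice : IsLattice W
  lattice_lower : IsLattice (lower W p b)

/-- The letter to be raised is not necessarily the first one where the words differ. That position
`m` only determines the target `b = V m`; the raised letter is the largest one below `b` between `m`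
and the next `b`, so that nothing intermediate is jumped over. -/
theorem exists_lowering {V W : ℕ → ℕ} (hV : IsLattice V) (hW : IsLattice W)
    (hsupp : ∀ i, V i = 0 ↔ W i = 0) {N : ℕ} (hN : ∀ i, N ≤ i → W i = 0)
    (hle : ∀ e n, cumCount V e n ≤ cumCount W e n) (hne : V ≠ W) :
    ∃ p b, IsLowering W p b ∧ ∀ e n, cumCount V e n ≤ cumCount (lower W p b) e n := by
  classical
  have hex : ∃ i, V i ≠ W i := by
    by_contra! h
    exact hne (funext h)
  obtain ⟨m, hm, hmin⟩ : ∃ m, V m ≠ W m ∧ ∀ i < m, V i = W i :=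
    ⟨Nat.find hex, Nat.find_spec hex, fun i hi => not_not.1 (Nat.find_min hex hi)⟩
  have hm0 := hsupp m
  -- Up to `m` the words agree, so dominance at level `V m` and length `m + 1` forces `W m` to be
  -- nonzero and at most `V m`.
  have hbm : 1 ≤ W m ∧ W m < V m := by
    have h1 := hle (V m) (m + 1)
    rw [cumCount_succ, cumCount_succ, cumCount_congr _ hmin, if_pos (by omega)] at h1
    split_ifs at h1 <;> omega
  set b := V m with hb
  -- the positions from `m` on, before the next letter `b`, which carry a letter smaller than `b`
  let T := (Finset.Ico m N).filter fun i =>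
    1 ≤ W i ∧ W i < b ∧ letterCount W b i = letterCount W b m
  have hmN : m < N := by
    by_contra! h
    have := hN m h
    omega
  have hmT : m ∈ T := by simp [T, hmN, hbm]
  -- The lexicographic maximum is the rightmost occurrence of the largest letter below `b`. Taking
  -- the rightmost one excludes further letters `W p` in the window after `p`.
  obtain ⟨p, hpT, hpmax⟩ := T.exists_max_image (fun i => toLex (W i, i)) ⟨m, hmT⟩
  simp only [T, Finset.mem_filter, Finset.mem_Ico, and_imp] at hpT hpmax
  obtain ⟨⟨hmp, hpN⟩, hp1, hpb, hpc⟩ := hpT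
  have hno : ∀ i, m ≤ i → letterCount W b (i + 1) = letterCount W b m →
      W i < W p ∨ (W i = W p ∧ i ≤ p) ∨ b < W i := by
    intro i hmi hi
    have h1 := letterCount_mono W b hmi
    rw [letterCount_succ] at hi
    by_cases hib : W i = b
    · rw [if_pos hib] at hi; omega
    · rw [if_neg hib, add_zero] at hi
      by_cases h0 : 1 ≤ W i ∧ W i < b
      · have hiN : i < N := by
          by_contra! h
          have := hN i h
          omega
        have := hpmax i hmi hiN h0.1 h0.2 hi
        rw [Prod.Lex.toLex_le_toLex] at this
        rcases this with h | h
        · exact Or.inl h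
        · exact Or.inr (Or.inl h)
      · omega
  -- counts of the letters in `(W p, b]` do not change as long as there is no further `b`
  have hconst : ∀ n, m ≤ n → letterCount W b n = letterCount W b m → ∀ f, W p < f → f ≤ b →
      letterCount W f n = letterCount W f m := by
    intro n hmn hn f hf hfb
    induction n, hmn using Nat.le_induction with
    | base => rfl
    | succ n hmn ih =>
      have h1 := letterCount_mono W b hmn
      have h2 := hno n hmn hn
      have h3 : letterCount W b n = letterCount W b m := by
        rw [letterCount_succ] at hn
        split_ifs at hn <;> omega
      rw [letterCount_succ, if_neg (by omega), ih h3]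
      rfl
  -- `V` is a lattice word with letter `b` in position `m`, and it agrees with `W` before `m`; hence
  -- `W` has room for one more `b` there.
  have haddb : letterCount W b m + 1 ≤ letterCount W (b - 1) m := by
    have h1 := hV (m + 1) (b - 1) (by omega)
    rw [Nat.sub_add_cancel (by omega), letterCount_succ, letterCount_succ, if_pos rfl,
      if_neg (by omega), letterCount_congr _ hmin, letterCount_congr _ hmin] at h1
    exact h1
  refine ⟨p, b, ⟨hp1, hpb, ?_, hW, ?_⟩, ?_⟩
  · intro i hpi hi
    by_contra! h
    have h1 := hno i (by omega) (by rw [letterCount_succ, if_neg (by omega), hi, hpc, add_zero])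
    omega
  · intro n e he
    have h1 := letterCount_lower W hpb.ne e n
    have h2 := letterCount_lower W hpb.ne (e + 1) n
    have h3 := hW n e he
    by_cases hI : p < n ∧ letterCount W b n = letterCount W b p
    · simp only [hI.1, hI.2, true_and] at h1 h2
      have hmn : m ≤ n := by omega
      have h4 := hconst n hmn (hI.2.trans hpc)
      have h5 : letterCount W (W p) m + 1 ≤ letterCount W (W p) n := by
        have := letterCount_lt (W := W) (e := W p) rfl hI.1
        have := letterCount_mono W (W p) hmp
        omega
      by_cases heb : e + 1 = b
      · have h6 := h4 b hpb le_rfl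
        have hbe : b - 1 = e := by omega
        rw [hbe] at haddb
        have h7 := letterCount_mono W e hmn
        by_cases hg : W p = e
        · rw [hg] at h5
          rw [if_pos hg, if_neg (by omega)] at h1
          rw [if_neg (by omega), if_pos heb.symm] at h2
          rw [heb] at h2 ⊢
          omega
        · rw [if_neg hg, if_neg (by omega)] at h1
          rw [if_neg (by omega), if_pos heb.symm] at h2
          rw [heb] at h2 ⊢
          omega
      · by_cases hg : W p = e
        · have h6 := h4 (e + 1) (by omega) (by omega)
          have h7 := hW m e he
          rw [hg] at h5
          rw [if_pos hg, if_neg (by omega)] at h1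
          rw [if_neg (by omega), if_neg (by omega)] at h2
          omega
        · rw [if_neg hg] at h1
          rw [if_neg (show ¬ b = e + 1 by omega)] at h2
          omega
    · have hI' : ∀ Q : Prop, ¬ (p < n ∧ letterCount W b n = letterCount W b p ∧ Q) :=
        fun Q hQ => hI ⟨hQ.1, hQ.2.1⟩
      simp only [hI', if_false, add_zero] at h1 h2
      omega
  · intro e n
    have h1 := cumCount_lower W hp1 hpb e n
    have h2 := hle e n
    split_ifs at h1 with hI
    · obtain ⟨hpn, hcn, hge, heb⟩ := hI
      have hmn : m ≤ n := by omega
      have h3 := hle b n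
      rw [cumCount_add_sum V heb.le, cumCount_add_sum W heb.le] at h3
      -- The count drops by one exactly here, so strict inequality is needed. In the window `W` has
      -- gained no letter of `(e, b]` since `m`, whereas `V` has gained the `b` in position `m`;
      -- subtracting from the inequality at level `b` gives strictness at level `e`.
      have h4 : ∑ f ∈ Finset.Ioc e b, letterCount W f n <
          ∑ f ∈ Finset.Ioc e b, letterCount V f n := by
        have key : ∀ f ∈ Finset.Ioc e b, letterCount W f n = letterCount V f m := by
          intro f hf
          rw [Finset.mem_Ioc] at hf
          rw [hconst n hmn (hcn.trans hpc) f (by omega) hf.2, letterCount_congr _ hmin]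
        refine Finset.sum_lt_sum (fun f hf => ?_) ⟨b, ?_, ?_⟩
        · rw [key f hf]
          exact letterCount_mono V f hmn
        · simp [heb]
        · rw [key b (by simp [heb])]
          exact letterCount_lt rfl (by omega)
      omega
    · omega

end LRInv

namespace LRInv

/-! ### Rook strips and row words -/

variable {r : ℕ} {β γ : YoungDiagram}

theorem eq_rowLen_of_mem_strip (hR : IsRookStrip β γ) {i j : ℕ}
    (h : (i, j) ∈ β.cells \ γ.cells) :
    j = γ.rowLen i := by
  have h1 := hR.2.2 i
  simp only [YoungDiagram.colLen_transpose] at h1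
  simp only [Finset.mem_sdiff, YoungDiagram.mem_cells, YoungDiagram.mem_iff_lt_rowLen] at h
  omega

/-- The rows which meet `β ∖ γ`. -/
def stripRows (β γ : YoungDiagram) : Finset ℕ := (β.cells \ γ.cells).image Prod.fst

/-- The row word of a filling of a rook strip. -/
def rowWord (γ : YoungDiagram) (t : ℕ × ℕ → ℕ) (i : ℕ) : ℕ := t (i, γ.rowLen i)

theorem mem_stripRows (hR : IsRookStrip β γ) {i : ℕ} :
    i ∈ stripRows β γ ↔ (i, γ.rowLen i) ∈ β.cells \ γ.cells := by
  constructor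
  · intro h
    obtain ⟨⟨i', j⟩, hc, rfl⟩ := Finset.mem_image.1 h
    rwa [← eq_rowLen_of_mem_strip hR hc]
  · exact fun h => Finset.mem_image.2 ⟨_, h, rfl⟩

theorem mem_stripRows' (hR : IsRookStrip β γ) {i : ℕ} :
    i ∈ stripRows β γ ↔ (i, γ.rowLen i) ∈ β := by
  rw [mem_stripRows hR, Finset.mem_sdiff]
  simp [YoungDiagram.mem_iff_lt_rowLen]

theorem card_filter_strip (hR : IsRookStrip β γ) (P : ℕ × ℕ → Prop) [DecidablePred P] :
    ((β.cells \ γ.cells).filter P).card =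
      ((stripRows β γ).filter fun i => P (i, γ.rowLen i)).card := by
  refine Finset.card_nbij' Prod.fst (fun i => (i, γ.rowLen i)) ?_ ?_ ?_ ?_
  · rintro ⟨i, j⟩ h
    simp only [Finset.coe_filter, Set.mem_ofPred_eq] at h ⊢
    rw [← eq_rowLen_of_mem_strip hR h.1]
    exact ⟨Finset.mem_image.2 ⟨_, h.1, rfl⟩, h.2⟩
  · intro i h
    simp only [Finset.coe_filter, Set.mem_ofPred_eq] at h ⊢
    exact ⟨(mem_stripRows hR).1 h.1, h.2⟩
  · rintro ⟨i, j⟩ h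
    simp only [Finset.coe_filter, Set.mem_ofPred_eq] at h
    exact Prod.ext rfl (eq_rowLen_of_mem_strip hR h.1).symm
  · exact fun i _ => rfl

theorem card_strip (hsub : γ ≤ β) (hw : β.card = γ.card + r) : (β.cells \ γ.cells).card = r := by
  have h := Finset.card_sdiff_add_card_eq_card (s := γ.cells) (t := β.cells) hsub
  change _ + γ.card = β.card at h
  omega

theorem card_stripRows (hR : IsRookStrip β γ) (hw : β.card = γ.card + r) :
    (stripRows β γ).card = r := by
  have := card_filter_strip hR (fun _ => True)
  simp only [Finset.filter_true] at this
  rw [← this, card_strip hR.1.1 hw]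

theorem colLen_rowLen (hR : IsRookStrip β γ) {i : ℕ} (hi : i ∈ stripRows β γ) :
    β.colLen (γ.rowLen i) = i + 1 := by
  have h1 := hR.1.2 (γ.rowLen i)
  have h2 := (mem_stripRows hR).1 hi
  simp only [Finset.mem_sdiff, YoungDiagram.mem_cells, YoungDiagram.mem_iff_lt_colLen] at h2
  omega

/-- The column of the strip cell in row `i` has length `i + 1` in `β` and so at least `i` in `γ`.
Hence strip columns decrease strictly downwards, and reading columns from the right is reading rows
from the top. -/
theorem rowLen_lt_of_lt (hR : IsRookStrip β γ) {i i' : ℕ} (hi : i ∈ stripRows β γ) (h : i' < i) :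
    γ.rowLen i < γ.rowLen i' := by
  have h1 := hR.1.2 (γ.rowLen i)
  rw [colLen_rowLen hR hi] at h1
  rw [← YoungDiagram.mem_iff_lt_rowLen, YoungDiagram.mem_iff_lt_colLen]
  omega

theorem rowLen_injOn (hR : IsRookStrip β γ) {i i' : ℕ} (hi : i ∈ stripRows β γ)
    (hi' : i' ∈ stripRows β γ) (h : γ.rowLen i = γ.rowLen i') : i = i' := by
  rcases lt_trichotomy i i' with h1 | h1 | h1
  · have := rowLen_lt_of_lt hR hi' h1; omega
  · exact h1
  · have := rowLen_lt_of_lt hR hi h1; omega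

theorem letterCount_eq_card (W : ℕ → ℕ) {S : Finset ℕ} (hS : ∀ i, W i ≠ 0 → i ∈ S) {e : ℕ}
    (he : e ≠ 0) (n : ℕ) : letterCount W e n = (S.filter fun i => i < n ∧ W i = e).card := by
  rw [letterCount, Nat.count_eq_card_filter_range]
  congr 1
  ext i
  simp only [Finset.mem_filter, Finset.mem_range]
  constructor
  · exact fun h => ⟨hS i (by omega), h⟩
  · exact fun h => h.2

theorem cumCount_eq_card (W : ℕ → ℕ) {S : Finset ℕ} (hS : ∀ i, W i ≠ 0 ↔ i ∈ S) (e n : ℕ) :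
    cumCount W e n = (S.filter fun i => i < n ∧ W i ≤ e).card := by
  rw [cumCount, Nat.count_eq_card_filter_range]
  congr 1
  ext i
  simp only [Finset.mem_filter, Finset.mem_range, ← hS]
  omega

/-- A Young diagram with given row lengths. -/
theorem exists_rowLen_eq (f : ℕ → ℕ) (hf : Antitone f) {N : ℕ} (hN : f N = 0) :
    ∃ α : YoungDiagram, (∀ e, α.rowLen e = f e) ∧ α.card = ∑ e ∈ Finset.range N, f e := by
  let α : YoungDiagram :=
    { cells := (Finset.range N).biUnion fun e => {e} ×ˢ Finset.range (f e)
      isLowerSet := by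
        rintro ⟨i', j'⟩ ⟨i, j⟩ hle hmem
        obtain ⟨hi, hj⟩ : i ≤ i' ∧ j ≤ j' := hle
        simp only [Finset.coe_biUnion, Finset.coe_range, Set.mem_Iio, Set.mem_iUnion,
          Finset.coe_product, Finset.coe_singleton, Set.mem_prod, Set.mem_singleton_iff] at hmem ⊢
        obtain ⟨e, he, rfl, hj'⟩ := hmem
        have := hf hi
        exact ⟨i, by omega, rfl, by omega⟩ }
  have hmem : ∀ i j, (i, j) ∈ α ↔ j < f i := by
    intro i j
    rw [← YoungDiagram.mem_cells]
    simp only [α, Finset.mem_biUnion, Finset.mem_range, Finset.mem_product,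
      Finset.mem_singleton]
    constructor
    · rintro ⟨e, he, rfl, hj⟩
      exact hj
    · intro h
      refine ⟨i, ?_, rfl, h⟩
      by_contra! hi
      have := hf hi
      omega
  refine ⟨α, fun e => ?_, ?_⟩
  · refine le_antisymm ?_ ?_
    · by_contra! h
      rw [← YoungDiagram.mem_iff_lt_rowLen, hmem] at h
      omega
    · by_contra! h
      rw [← hmem, YoungDiagram.mem_iff_lt_rowLen] at h
      omega
  · change α.cells.card = _
    rw [Finset.card_biUnion]
    · simp
    · intro x _ y _ hxy
      rw [Function.onFun, Finset.disjoint_left]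
      rintro ⟨i, j⟩ h1 h2
      simp only [Finset.mem_product, Finset.mem_singleton] at h1 h2
      exact hxy (h1.1.symm.trans h2.1)

theorem rowWord_ne_zero_iff (hR : IsRookStrip β γ) (Γ : LRTableaux r β γ) (i : ℕ) :
    rowWord γ Γ.1 i ≠ 0 ↔ i ∈ stripRows β γ := by
  obtain ⟨α, -, h⟩ := Γ.2
  rw [mem_stripRows hR]
  constructor
  · intro hi
    by_contra hc
    exact hi (h.eq_zero _ hc)
  · intro hi
    have := h.pos _ hi
    exact Nat.ne_of_gt this

/-- The row words of LR-tableaux are lattice words. -/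
theorem isLattice_rowWord (hR : IsRookStrip β γ) (Γ : LRTableaux r β γ) :
    IsLattice (rowWord γ Γ.1) := by
  have hs := rowWord_ne_zero_iff hR Γ
  obtain ⟨α, -, h⟩ := Γ.2
  intro n e he
  rcases n with _ | n
  · simp [letterCount_zero]
  · obtain ⟨e, rfl⟩ : ∃ e', e = e' + 1 := ⟨e - 1, by omega⟩
    have h1 := h.lattice (γ.rowLen n) e
    rw [card_filter_strip hR, card_filter_strip hR] at h1
    rw [letterCount_eq_card _ (fun i => (hs i).1) (by omega),
      letterCount_eq_card _ (fun i => (hs i).1) (by omega)]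
    have key : ∀ i ∈ stripRows β γ, γ.rowLen n ≤ γ.rowLen i ↔ i < n + 1 := by
      intro i hi
      constructor
      · intro h'
        by_contra! hc
        have := rowLen_lt_of_lt hR hi (show n < i by omega)
        omega
      · exact fun h' => γ.rowLen_anti _ _ (by omega)
    convert h1 using 2
    · refine Finset.filter_congr fun i hi => ?_
      rw [key i hi]; rfl
    · refine Finset.filter_congr fun i hi => ?_
      rw [key i hi]; rfl

/-! ### From lattice words back to tableaux. -/

/-- The filling of `β ∖ γ` with given row word. -/
def ofWord (β γ : YoungDiagram) (W : ℕ → ℕ) (c : ℕ × ℕ) : ℕ :=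
  if c ∈ β.cells \ γ.cells then W c.1 else 0

theorem ofWord_mem (hR : IsRookStrip β γ) (hw : β.card = γ.card + r) {W : ℕ → ℕ}
    (hs : ∀ i, W i ≠ 0 ↔ i ∈ stripRows β γ) (hW : IsLattice W) :
    ofWord β γ W ∈ LRTableaux r β γ := by
  classical
  have hval : ∀ i ∈ stripRows β γ, ofWord β γ W (i, γ.rowLen i) = W i := fun i hi => by
    rw [ofWord, if_pos ((mem_stripRows hR).1 hi)]
  obtain ⟨N, hN⟩ : ∃ N, ∀ i ∈ stripRows β γ, i < N := ⟨(stripRows β γ).sup id + 1, fun i hi => by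
    have := Finset.le_sup (f := id) hi
    simp only [id] at this
    omega⟩
  have hcnt : ∀ e ≠ 0, ((β.cells \ γ.cells).filter fun c => ofWord β γ W c = e).card =
      letterCount W e N := by
    intro e he
    rw [card_filter_strip hR, letterCount_eq_card W (fun i => (hs i).1) he]
    congr 1
    refine Finset.filter_congr fun i hi => ?_
    rw [hval i hi]
    simp [hN i hi]
  -- The letter counts of the whole word are the row lengths of the content: the lattice condition
  -- makes them decrease, and a letter in row `i` is at most `i + 1`, so they vanish eventually.
  obtain ⟨α, hα, hαc⟩ := exists_rowLen_eq (fun e => letterCount W (e + 1) N)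
    (antitone_nat_of_succ_le fun e => hW N (e + 1) (by omega)) (N := N + 1) (by
      rw [letterCount_eq_card W (fun i => (hs i).1) (by omega), Finset.card_eq_zero,
        Finset.filter_eq_empty_iff]
      intro i hi h
      have := hW.le_succ i
      have := hN i hi
      omega)
  refine ⟨α, ?_, hR.1.1, ?_, ?_, ?_, ?_, ?_, ?_⟩
  · rw [hαc, ← card_strip hR.1.1 hw]
    rw [Finset.card_eq_sum_card_fiberwise (f := fun c => ofWord β γ W c - 1)
      (t := Finset.range (N + 1))]
    · refine Finset.sum_congr rfl fun e _ => ?_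
      rw [← hcnt (e + 1) (by omega)]
      congr 1
      refine Finset.filter_congr fun c hc => ?_
      have h0 : ofWord β γ W c ≠ 0 := by
        rw [ofWord, if_pos hc, hs]
        exact Finset.mem_image.2 ⟨_, hc, rfl⟩
      omega
    · intro c hc
      simp only [Finset.coe_range, Set.mem_Iio]
      rw [ofWord, if_pos (Finset.mem_coe.1 hc)]
      have h1 := hW.le_succ c.1
      have h2 := hN c.1 (Finset.mem_image.2 ⟨_, hc, rfl⟩)
      omega
  · intro c hc
    rw [ofWord, if_neg hc]
  · intro c hc
    rw [ofWord, if_pos hc]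
    exact Nat.one_le_iff_ne_zero.2 ((hs _).2 (Finset.mem_image.2 ⟨_, hc, rfl⟩))
  · intro e
    rw [hα, hcnt (e + 1) (by omega)]
  · intro i j j' hj h1 h2
    have := eq_rowLen_of_mem_strip hR h1
    have := eq_rowLen_of_mem_strip hR h2
    omega
  · intro i i' j hi h1 h2
    have h3 := eq_rowLen_of_mem_strip hR h1
    have h4 := eq_rowLen_of_mem_strip hR h2
    have := rowLen_lt_of_lt hR (Finset.mem_image.2 ⟨_, h2, rfl⟩) hi
    simp only at this
    omega
  · intro j e
    rw [card_filter_strip hR, card_filter_strip hR]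
    -- The strip cells in columns at least `j` are those in an initial segment of rows; for `j + 1`
    -- its length is `γ.colLen j`, and for `0` it is everything.
    obtain ⟨n, hn⟩ : ∃ n, ∀ i ∈ stripRows β γ, j ≤ γ.rowLen i ↔ i < n := by
      rcases j with _ | j
      · exact ⟨N, fun i hi => by simp [hN i hi]⟩
      · refine ⟨γ.colLen j, fun i _ => ?_⟩
        rw [← YoungDiagram.mem_iff_lt_colLen, YoungDiagram.mem_iff_lt_rowLen]
        omega
    have h1 := hW n (e + 1) (by omega)
    rw [letterCount_eq_card W (fun i => (hs i).1) (by omega),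
      letterCount_eq_card W (fun i => (hs i).1) (by omega)] at h1
    convert h1 using 2
    · refine Finset.filter_congr fun i hi => ?_
      simp only [hn i hi, hval i hi]
    · refine Finset.filter_congr fun i hi => ?_
      simp only [hn i hi, hval i hi]

theorem rowWord_ofWord (hR : IsRookStrip β γ) {W : ℕ → ℕ}
    (hs : ∀ i, W i ≠ 0 ↔ i ∈ stripRows β γ) : rowWord γ (ofWord β γ W) = W := by
  funext i
  rw [rowWord, ofWord]
  by_cases hi : i ∈ stripRows β γ
  · rw [if_pos ((mem_stripRows hR).1 hi)]
  · rw [if_neg fun h => hi ((mem_stripRows hR).2 h)]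
    by_contra h
    exact hi ((hs i).1 (Ne.symm h))

theorem ofWord_rowWord (hR : IsRookStrip β γ) (Γ : LRTableaux r β γ) :
    ofWord β γ (rowWord γ Γ.1) = Γ.1 := by
  obtain ⟨α, -, h⟩ := Γ.2
  funext ⟨i, j⟩
  rw [ofWord]
  split_ifs with hc
  · have := eq_rowLen_of_mem_strip hR hc
    simp only [rowWord, this]
  · exact (h.eq_zero _ hc).symm

theorem eq_of_rowWord_eq (hR : IsRookStrip β γ) {Δ Γ : LRTableaux r β γ}
    (h : rowWord γ Δ.1 = rowWord γ Γ.1) : Δ = Γ :=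
  Subtype.ext (by rw [← ofWord_rowWord hR Δ, h, ofWord_rowWord hR Γ])

/-! ### Dominance in terms of row words -/

theorem mem_level (Γ : LRTableaux r β γ) (e : ℕ) (c : ℕ × ℕ) :
    c ∈ level Γ e ↔ c ∈ β ∧ Γ.1 c ≤ e := by
  rw [← YoungDiagram.mem_cells]
  simp [level]

theorem rowLen_level (hR : IsRookStrip β γ) (Γ : LRTableaux r β γ) (e i : ℕ) :
    (level Γ e).rowLen i =
      γ.rowLen i + if i ∈ stripRows β γ ∧ rowWord γ Γ.1 i ≤ e then 1 else 0 := by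
  have h0 : ∀ j, j < γ.rowLen i → (i, j) ∈ level Γ e := by
    intro j hj
    rw [← YoungDiagram.mem_iff_lt_rowLen] at hj
    rw [mem_level]
    refine ⟨hR.1.1 hj, ?_⟩
    obtain ⟨α, -, h⟩ := Γ.2
    rw [h.eq_zero _ (by simp [hj])]
    exact Nat.zero_le _
  have h1 : ∀ j, (i, j) ∈ level Γ e → γ.rowLen i ≤ j →
      j = γ.rowLen i ∧ i ∈ stripRows β γ ∧ rowWord γ Γ.1 i ≤ e := by
    intro j hj hij
    rw [mem_level] at hj
    have hc : (i, j) ∈ β.cells \ γ.cells := by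
      simp [hj.1, YoungDiagram.mem_iff_lt_rowLen, hij]
    have := eq_rowLen_of_mem_strip hR hc
    subst this
    exact ⟨rfl, (mem_stripRows hR).2 hc, hj.2⟩
  have hge : γ.rowLen i ≤ (level Γ e).rowLen i := by
    by_contra! h
    have := h0 _ h
    rw [YoungDiagram.mem_iff_lt_rowLen] at this
    omega
  split_ifs with h
  · have h2 : (i, γ.rowLen i) ∈ level Γ e :=
      (mem_level _ _ _).2 ⟨(mem_stripRows' hR).1 h.1, h.2⟩
    rw [YoungDiagram.mem_iff_lt_rowLen] at h2
    by_contra hne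
    have h3 : (i, γ.rowLen i + 1) ∈ level Γ e := by
      rw [YoungDiagram.mem_iff_lt_rowLen]; omega
    have := (h1 _ h3 (by omega)).1
    omega
  · by_contra hne
    have h3 : (i, γ.rowLen i) ∈ level Γ e := by
      rw [YoungDiagram.mem_iff_lt_rowLen]; omega
    exact h (h1 _ h3 le_rfl).2

theorem sum_rowLen_level (hR : IsRookStrip β γ) (Γ : LRTableaux r β γ) (e n : ℕ) :
    ∑ i ∈ Finset.range n, (level Γ e).rowLen i =
      ∑ i ∈ Finset.range n, γ.rowLen i + cumCount (rowWord γ Γ.1) e n := by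
  have hs := rowWord_ne_zero_iff hR Γ
  induction n with
  | zero => simp [cumCount_zero]
  | succ n ih =>
    rw [Finset.sum_range_succ, Finset.sum_range_succ, ih, cumCount_succ, rowLen_level hR]
    have h1 : (n ∈ stripRows β γ ∧ rowWord γ Γ.1 n ≤ e) ↔
        (1 ≤ rowWord γ Γ.1 n ∧ rowWord γ Γ.1 n ≤ e) := by
      rw [← hs, Nat.one_le_iff_ne_zero]
    simp only [h1]
    omega

/-- A letter `l` drags along its chain `1, …, l`, which occupies `l` different nonblank positions.
-/
theorem IsLattice.le_card {W : ℕ → ℕ} (hW : IsLattice W) {S : Finset ℕ}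
    (hS : ∀ i, W i ≠ 0 → i ∈ S) (i : ℕ) : W i ≤ S.card := by
  classical
  have : Finset.Icc 1 (W i) ⊆ S.image W := by
    intro l hl
    rw [Finset.mem_Icc] at hl
    obtain ⟨i', -, h, -⟩ := hW.exists_above hl.1 (W i - l) i (by omega)
    exact Finset.mem_image.2 ⟨i', hS i' (by omega), h⟩
  have h1 := (Finset.card_le_card this).trans Finset.card_image_le
  simpa using h1

theorem domLE_iff (hR : IsRookStrip β γ) (hw : β.card = γ.card + r) (Δ Γ : LRTableaux r β γ) :
    DomLE Δ Γ ↔ ∀ e n, cumCount (rowWord γ Δ.1) e n ≤ cumCount (rowWord γ Γ.1) e n := by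
  -- All letters are at most `r`, so the levels beyond `r`, which `DomLE` does not test, carry no
  -- further condition.
  have hcap : ∀ Γ : LRTableaux r β γ, ∀ e n, r ≤ e →
      cumCount (rowWord γ Γ.1) e n = cumCount (rowWord γ Γ.1) r n := by
    intro Γ e n he
    have hs := rowWord_ne_zero_iff hR Γ
    rw [cumCount_eq_card _ hs, cumCount_eq_card _ hs]
    congr 1
    refine Finset.filter_congr fun i _ => ?_
    have := (isLattice_rowWord hR Γ).le_card (fun i => (hs i).1) i
    rw [card_stripRows hR hw] at this
    omega
  have hiff : ∀ e, NatLE (level Δ e) (level Γ e) ↔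
      ∀ n, cumCount (rowWord γ Δ.1) e n ≤ cumCount (rowWord γ Γ.1) e n := by
    intro e
    refine forall_congr' fun n => ?_
    rw [sum_rowLen_level hR, sum_rowLen_level hR]
    omega
  constructor
  · intro h e n
    rcases le_total e r with he | he
    · exact (hiff e).1 (h e he) n
    · rw [hcap Δ e n he, hcap Γ e n he]
      exact (hiff r).1 (h r le_rfl) n
  · exact fun h e _ => (hiff e).2 (h e)

theorem level_card (hR : IsRookStrip β γ) (Γ : LRTableaux r β γ)
    (e : ℕ) : (level Γ e).card + ((stripRows β γ).filter fun i => e < rowWord γ Γ.1 i).card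
      = β.card := by
  have h1 : ((β.cells \ γ.cells).filter fun c => e < Γ.1 c) =
      β.cells.filter fun c => e < Γ.1 c := by
    ext c
    simp only [Finset.mem_filter]
    constructor
    · exact fun h => ⟨(Finset.mem_sdiff.1 h.1).1, h.2⟩
    · intro h
      refine ⟨?_, h.2⟩
      by_contra hc
      obtain ⟨α, -, ht⟩ := Γ.2
      have := ht.eq_zero _ hc
      omega
  have h2 := card_filter_strip hR fun c => e < Γ.1 c
  have h3 := Finset.card_filter_add_card_filter_not (s := β.cells) fun c => Γ.1 c ≤ e
  simp only [not_le] at h3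
  rw [h1] at h2
  unfold rowWord
  rw [← h2]
  exact h3

end LRInv

namespace LRInv

variable {r : ℕ} {β γ : YoungDiagram}

/-! ### The box order and the dominance order -/

/-- Only prefixes that contain `p` but not `j` notice the swap, and only at levels that separate the
two letters. -/
theorem cumCount_swap (W V : ℕ → ℕ) {p j : ℕ} (hpj : p < j) (hlt : W p < W j) (h1 : V p = W j)
    (h2 : V j = W p) (h : ∀ i, i ≠ p → i ≠ j → V i = W i) (hp : 1 ≤ W p) (e n : ℕ) :
    cumCount V e n + (if p < n ∧ n ≤ j ∧ W p ≤ e ∧ e < W j then 1 else 0) = cumCount W e n := by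
  induction n with
  | zero => simp [cumCount_zero]
  | succ n ih =>
    rw [cumCount_succ, cumCount_succ]
    by_cases hnp : n = p
    · subst hnp
      rw [h1]
      split_ifs at ih ⊢ <;> omega
    · by_cases hnj : n = j
      · subst hnj
        rw [h2]
        split_ifs at ih ⊢ <;> omega
      · rw [h n hnp hnj]
        split_ifs at ih ⊢ <;> omega

theorem cumCount_le_of_le {W V : ℕ → ℕ} (h : ∀ i, W i ≤ V i) (h0 : ∀ i, V i ≠ 0 → W i ≠ 0)
    (e n : ℕ) : cumCount V e n ≤ cumCount W e n := by
  induction n with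
  | zero => simp [cumCount_zero]
  | succ n ih =>
    rw [cumCount_succ, cumCount_succ]
    have := h n
    have := h0 n
    split_ifs <;> omega

theorem BoxMove.domLE (hR : IsRookStrip β γ) (hw : β.card = γ.card + r) {Δ Γ : LRTableaux r β γ}
    (h : BoxMove Δ Γ) : DomLE Δ Γ := by
  rw [domLE_iff hR hw]
  intro e n
  rcases h with ⟨⟨p, p'⟩, hc, ⟨j, j'⟩, hd, hlt, hval, hΔ⟩ | ⟨⟨p, p'⟩, hc, m, hm, hΔ⟩
  · have hp' := eq_rowLen_of_mem_strip hR hc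
    have hj' := eq_rowLen_of_mem_strip hR hd
    subst hp' hj'
    simp only at hlt
    have := cumCount_swap (rowWord γ Γ.1) (rowWord γ Δ.1) hlt hval
      (by simp [rowWord, hΔ]) (by simp [rowWord, hΔ])
      (fun i h1 h2 => by
        simp only [rowWord, hΔ, Function.comp]
        rw [Equiv.swap_apply_of_ne_of_ne] <;> simp [h1, h2])
      (Nat.one_le_iff_ne_zero.2 ((rowWord_ne_zero_iff hR Γ p).2 ((mem_stripRows hR).2 hc))) e n
    omega
  · refine cumCount_le_of_le (fun i => ?_) (fun i => ?_) e n
    · simp only [rowWord, hΔ, Function.update_apply]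
      split_ifs with hi
      · rw [hi]; exact hm.le
      · exact le_rfl
    · rw [rowWord_ne_zero_iff hR Γ, rowWord_ne_zero_iff hR Δ]
      exact id

theorem BoxLE.domLE (hR : IsRookStrip β γ) (hw : β.card = γ.card + r) {Δ Γ : LRTableaux r β γ}
    (h : BoxLE Δ Γ) : DomLE Δ Γ := by
  rw [domLE_iff hR hw]
  induction h with
  | refl => exact fun e n => le_rfl
  | tail _ h ih =>
    exact fun e n => (ih e n).trans ((domLE_iff hR hw _ _).1 (h.domLE hR hw) e n)

/-! ### Lowering moves generate the dominance order. -/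

/-- `Δ` arises from `Γ` by a lowering of the row word. -/
def LowerMove (Δ Γ : LRTableaux r β γ) : Prop :=
  ∃ p b, IsLowering (rowWord γ Γ.1) p b ∧ rowWord γ Δ.1 = lower (rowWord γ Γ.1) p b

theorem LowerMove.boxMove (hR : IsRookStrip β γ) {Δ Γ : LRTableaux r β γ} (h : LowerMove Δ Γ) :
    BoxMove Δ Γ := by
  obtain ⟨p, b, hL, hΔ⟩ := h
  have hp : p ∈ stripRows β γ := (rowWord_ne_zero_iff hR Γ p).1 (by have := hL.pos; omega)
  have hcp := (mem_stripRows hR).1 hp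
  by_cases hj : ∃ j, IsNext (rowWord γ Γ.1) p b j
  · obtain ⟨j, hj⟩ := hj
    have hjS : j ∈ stripRows β γ := (rowWord_ne_zero_iff hR Γ j).1 (by
      have := hL.lt; have := hj.2.1; omega)
    have hcj := (mem_stripRows hR).1 hjS
    refine Or.inl ⟨_, hcp, _, hcj, hj.1, ?_, ?_⟩
    · have := hL.lt
      rw [← hj.2.1] at this
      exact this
    · rw [← ofWord_rowWord hR Δ, hΔ]
      funext ⟨i, i'⟩
      rw [ofWord, Function.comp]
      by_cases hi : (i, i') ∈ β.cells \ γ.cells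
      · rw [if_pos hi]
        have := eq_rowLen_of_mem_strip hR hi
        subst this
        by_cases hip : i = p
        · subst hip
          rw [Equiv.swap_apply_left, lower_self]
          exact hj.2.1.symm
        · by_cases hij : i = j
          · subst hij
            rw [Equiv.swap_apply_right, lower_next hj]
            rfl
          · rw [Equiv.swap_apply_of_ne_of_ne (by simp [hip]) (by simp [hij]),
              lower_of_ne hip fun h => hij (h.unique hj)]
            rfl
      · rw [if_neg hi, Equiv.swap_apply_of_ne_of_ne (by rintro h; rw [h] at hi; exact hi hcp)
          (by rintro h; rw [h] at hi; exact hi hcj)]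
        obtain ⟨α, -, h⟩ := Γ.2
        exact (h.eq_zero _ hi).symm
  · push Not at hj
    refine Or.inr ⟨_, hcp, b, hL.lt, ?_⟩
    rw [← ofWord_rowWord hR Δ, hΔ]
    funext ⟨i, i'⟩
    rw [ofWord, Function.update_apply]
    by_cases hi : (i, i') ∈ β.cells \ γ.cells
    · rw [if_pos hi]
      have := eq_rowLen_of_mem_strip hR hi
      subst this
      by_cases hip : i = p
      · subst hip
        simp [lower_self]
      · rw [lower_of_ne hip (hj i), if_neg (by simp [hip])]
        rfl
    · rw [if_neg hi, if_neg (by rintro h; rw [h] at hi; exact hi hcp)]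
      obtain ⟨α, -, h⟩ := Γ.2
      exact (h.eq_zero _ hi).symm

/-- Induction on the sum of all counts of the upper word over the finite range of relevant levels
and lengths; a lowering decreases none of the others and strictly decreases the one at level `W p`
and length `p + 1`. -/
theorem DomLE.reflTransGen_lowerMove (hR : IsRookStrip β γ) (hw : β.card = γ.card + r)
    {Δ Γ : LRTableaux r β γ} (h : DomLE Δ Γ) : Relation.ReflTransGen LowerMove Δ Γ := by
  obtain ⟨N, hN⟩ : ∃ N, ∀ i ∈ stripRows β γ, i < N := ⟨(stripRows β γ).sup id + 1, fun i hi => by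
    have := Finset.le_sup (f := id) hi
    simp only [id] at this
    omega⟩
  rw [domLE_iff hR hw] at h
  induction hM : ∑ x ∈ Finset.range (r + 1) ×ˢ Finset.range (N + 1),
      cumCount (rowWord γ Γ.1) x.1 x.2 using Nat.strong_induction_on generalizing Γ with
  | _ M ih =>
    by_cases hne : rowWord γ Δ.1 = rowWord γ Γ.1
    · rw [eq_of_rowWord_eq hR hne]
    have hsΓ := rowWord_ne_zero_iff hR Γ
    have hsΔ := rowWord_ne_zero_iff hR Δ
    obtain ⟨p, b, hL, hle⟩ := exists_lowering (isLattice_rowWord hR Δ) (isLattice_rowWord hR Γ)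
      (fun i => not_iff_not.1 ((hsΔ i).trans (hsΓ i).symm)) (N := N) (fun i hi => by
        by_contra h'
        have := hN i ((hsΓ i).1 h')
        omega) h hne
    have hsup : ∀ i, lower (rowWord γ Γ.1) p b i ≠ 0 ↔ i ∈ stripRows β γ := by
      intro i
      have hpos := hL.pos
      have hlt := hL.lt
      rw [← hsΓ]
      by_cases hip : i = p
      · subst hip
        rw [lower_self]
        omega
      · by_cases hin : IsNext (rowWord γ Γ.1) p b i
        · rw [lower_next hin, hin.2.1]
          omega
        · rw [lower_of_ne hip hin]
    let Γ' : LRTableaux r β γ := ⟨_, ofWord_mem hR hw hsup hL.lattice_lower⟩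
    have hΓ' : rowWord γ Γ'.1 = lower (rowWord γ Γ.1) p b := rowWord_ofWord hR hsup
    refine (ih _ ?_ (Γ := Γ') (by rwa [hΓ']) rfl).tail ⟨p, b, hL, hΓ'⟩
    rw [← hM, hΓ']
    have hstep := cumCount_lower (rowWord γ Γ.1) hL.pos hL.lt
    refine Finset.sum_lt_sum (fun x _ => by have := hstep x.1 x.2; omega)
      ⟨(rowWord γ Γ.1 p, p + 1), ?_, ?_⟩
    · have h1 := hL.lattice.le_card (fun i => (hsΓ i).1) p
      rw [card_stripRows hR hw] at h1
      have h2 := hN p ((hsΓ p).1 (by have := hL.pos; omega))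
      simp only [Finset.mem_product, Finset.mem_range]
      omega
    · have h1 := hstep (rowWord γ Γ.1 p) (p + 1)
      rw [if_pos ⟨by omega, by rw [letterCount_succ, if_neg hL.lt.ne, add_zero], le_rfl, hL.lt⟩]
        at h1
      simp only
      omega

end LRInv

namespace LRInv
open Polynomial
open scoped Pointwise

/-! ### Nilpotent modules -/

section Nilp

variable {k : Type u} [Field k]

theorem finrank_cyclic (n : ℕ) :
    Module.finrank k (k[X] ⧸ Ideal.span {(X ^ n : k[X])}) = n := by
  rw [finrank_quotient_span_eq_natDegree]; simp

instance finite_cyclic (n : ℕ) : Module.Finite k (k[X] ⧸ Ideal.span {(X ^ n : k[X])}) :=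
  (monic_X_pow n).finite_quotient

theorem smul_one_quotient (I : Ideal k[X]) (f : k[X]) :
    f • (1 : k[X] ⧸ I) = Ideal.Quotient.mk I f := by
  change Ideal.Quotient.mk I (f • (1 : k[X])) = _
  rw [smul_eq_mul, mul_one]

theorem smul_one_cyclic (n : ℕ) :
    (X ^ n : k[X]) • (1 : k[X] ⧸ Ideal.span {(X ^ n : k[X])}) = 0 := by
  rw [smul_one_quotient]
  exact Ideal.Quotient.eq_zero_iff_mem.2 (Ideal.mem_span_singleton_self _)

theorem span_single_cyclic {ι : Type*} [Fintype ι] [DecidableEq ι] (l : ι → ℕ) :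
    Submodule.span k[X] (Set.range fun i =>
      (Pi.single i 1 : ∀ i, k[X] ⧸ Ideal.span {(X ^ l i : k[X])})) = ⊤ := by
  rw [eq_top_iff]
  intro y _
  rw [← Finset.univ_sum_single y]
  refine Submodule.sum_mem _ fun i _ => ?_
  obtain ⟨f, hf⟩ := Ideal.Quotient.mk_surjective (y i)
  have h1 : (Pi.single i (y i) : ∀ i, k[X] ⧸ Ideal.span {(X ^ l i : k[X])}) =
      f • Pi.single i 1 := by
    rw [← Pi.single_smul, ← hf, smul_one_quotient]
  rw [h1]
  exact Submodule.smul_mem _ _ (Submodule.subset_span ⟨i, rfl⟩)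

theorem card_eq_sum_colLen (α : YoungDiagram) :
    α.card = ∑ j : Fin (α.rowLen 0), α.colLen j := by
  rw [Fin.sum_univ_eq_sum_range (fun j => α.colLen j), YoungDiagram.card,
    Finset.card_eq_sum_card_fiberwise (f := Prod.snd) (t := Finset.range (α.rowLen 0))]
  · refine Finset.sum_congr rfl fun j _ => ?_
    rw [YoungDiagram.colLen_eq_card]
    rfl
  · rintro ⟨i, j⟩ h
    simp only [Finset.coe_range, Set.mem_Iio]
    rw [← YoungDiagram.mem_iff_lt_rowLen]
    exact α.up_left_mem (Nat.zero_le _) le_rfl h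

theorem finrank_nilpModule (α : YoungDiagram) : Module.finrank k (NilpModule k α) = α.card := by
  rw [Module.finrank_pi_fintype, card_eq_sum_colLen]
  exact Finset.sum_congr rfl fun j _ => finrank_cyclic _

/-- A module of dimension at least `|α|` with generators `gⱼ` annihilated by `X ^ αⱼ` is isomorphic
to `N_α`. -/
theorem nonempty_equiv_nilpModule {M : Type*} [AddCommGroup M] [Module k M] [Module k[X] M]
    [IsScalarTower k k[X] M] [FiniteDimensional k M] (α : YoungDiagram) (g : ℕ → M)
    (hg : ∀ j, (X ^ α.colLen j : k[X]) • g j = 0)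
    (hspan : Submodule.span k[X] (Set.range g) = ⊤) (hcard : α.card ≤ Module.finrank k M) :
    Nonempty (M ≃ₗ[k[X]] NilpModule k α) := by
  classical
  let φ : NilpModule k α →ₗ[k[X]] M := LinearMap.lsum k[X] _ k[X] fun j =>
    Submodule.liftQSpanSingleton (X ^ α.colLen j : k[X])
      (LinearMap.toSpanSingleton k[X] M (g j)) (by simpa using hg j)
  have hφ : ∀ j : Fin (α.rowLen 0), φ (Pi.single j 1) = g j := by
    intro j
    simp only [φ]
    rw [LinearMap.lsum_piSingle]
    change LinearMap.toSpanSingleton k[X] M (g j) 1 = g j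
    simp
  have hsurj : Function.Surjective φ := by
    rw [← LinearMap.range_eq_top, eq_top_iff, ← hspan, Submodule.span_le]
    rintro _ ⟨j, rfl⟩
    by_cases hj : j < α.rowLen 0
    · exact ⟨_, hφ ⟨j, hj⟩⟩
    -- Beyond the last column the relation reads `X ^ 0 • g j = 0`, so the superfluous generators
    -- vanish.
    · have h0 : α.colLen j = 0 := by
        by_contra h
        have : (0, j) ∈ α := by rw [YoungDiagram.mem_iff_lt_colLen]; omega
        rw [YoungDiagram.mem_iff_lt_rowLen] at this
        exact hj this
      have := hg j
      rw [h0, pow_zero, one_smul] at this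
      rw [this]
      exact Submodule.zero_mem _
  -- The generators give a surjection from `N_α`; the dimension hypothesis leaves no room for a
  -- kernel.
  have hle : Module.finrank k M ≤ Module.finrank k (NilpModule k α) :=
    LinearMap.finrank_le_finrank_of_surjective (f := φ.restrictScalars k) hsurj
  have heq : Module.finrank k (NilpModule k α) = Module.finrank k M :=
    le_antisymm (by rwa [finrank_nilpModule]) hle
  have hinj : Function.Injective φ :=
    (LinearMap.injective_iff_surjective_of_finrank_eq_finrank heq
      (f := φ.restrictScalars k)).2 hsurj
  exact ⟨(LinearEquiv.ofBijective φ ⟨hinj, hsurj⟩).symm⟩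

/-- Every finite dimensional nilpotent module is of the form `N_α`. -/
theorem exists_equiv_nilpModule (M : Type*) [AddCommGroup M] [Module k M] [Module k[X] M]
    [IsScalarTower k k[X] M] [FiniteDimensional k M]
    (hM : ∃ n : ℕ, ∀ b : M, (X ^ n : k[X]) • b = 0) :
    ∃ α : YoungDiagram, α.card = Module.finrank k M ∧ Nonempty (M ≃ₗ[k[X]] NilpModule k α) := by
  classical
  have : Module.Finite k[X] M := Module.Finite.of_restrictScalars_finite k k[X] M
  obtain ⟨n, hn⟩ := hM
  obtain ⟨d, l, ⟨φ⟩⟩ := Module.torsion_by_prime_power_decomposition (M := M)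
    (irreducible_X (R := k)) (fun {x} => ⟨⟨X ^ n, n, rfl⟩, hn x⟩)
  let ψ : M ≃ₗ[k[X]] (∀ i, k[X] ⧸ Ideal.span {(X ^ l i : k[X])}) :=
    φ.trans (DirectSum.linearEquivFunOnFintype k[X] (Fin d) _)
  -- The structure theorem gives unordered exponents. Sorting in the dual order makes them
  -- decreasing; they become row lengths first, and the transpose turns them into column lengths.
  let σ := Tuple.sort (fun i => OrderDual.toDual (l i))
  have hσ : ∀ i j : Fin d, i ≤ j → l (σ j) ≤ l (σ i) := fun i j hij =>
    Tuple.monotone_sort (fun i => OrderDual.toDual (l i)) hij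
  obtain ⟨α, hα, hc⟩ := exists_rowLen_eq (fun j => if h : j < d then l (σ ⟨j, h⟩) else 0)
    (fun i j hij => by
      by_cases hj : j < d
      · simp only [hj, lt_of_le_of_lt hij hj, dif_pos]
        exact hσ _ _ hij
      · simp [hj]) (N := d) (by simp)
  have hfin : Module.finrank k M = ∑ i, l i := by
    rw [(ψ.restrictScalars k).finrank_eq, Module.finrank_pi_fintype]
    exact Finset.sum_congr rfl fun i _ => finrank_cyclic _
  have hcard : α.transpose.card = Module.finrank k M := by
    have h1 : α.transpose.card = α.card := by
      simp [YoungDiagram.card, YoungDiagram.transpose]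
    rw [h1, hc, hfin, ← Equiv.sum_comp σ l, Finset.sum_range]
    exact Finset.sum_congr rfl fun i _ => by simp
  refine ⟨α.transpose, hcard, nonempty_equiv_nilpModule _
    (fun j => if h : j < d then ψ.symm (Pi.single (σ ⟨j, h⟩) 1) else 0) (fun j => ?_) ?_ hcard.le⟩
  · rw [YoungDiagram.colLen_transpose, hα]
    by_cases h : j < d
    · simp only [h, dif_pos]
      rw [← map_smul, ← Pi.single_smul, smul_one_cyclic, Pi.single_zero, map_zero]
    · simp [h]
  · have h1 := congrArg (Submodule.map ψ.symm.toLinearMap) (span_single_cyclic (k := k) l)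
    rw [Submodule.map_span, Submodule.map_top, LinearEquiv.range] at h1
    rw [eq_top_iff, ← h1, Submodule.span_le]
    rintro _ ⟨_, ⟨i, rfl⟩, rfl⟩
    refine Submodule.subset_span ⟨(σ.symm i : ℕ), ?_⟩
    have h2 : ∀ i', i' = i → ψ.symm (Pi.single i' 1) = ψ.symm.toLinearMap (Pi.single i 1) := by
      rintro _ rfl
      rfl
    simp only [(σ.symm i).2, dif_pos]
    exact h2 _ (by simp)

end Nilp

end LRInv

namespace LRInv
open Polynomial
open scoped Pointwise

section HomSpaces

variable {k : Type u} [Field k]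

/-! ### From extensions to homomorphisms -/

instance finite_linearMap (M N : Type*) [AddCommGroup M] [Module k M] [Module k[X] M]
    [IsScalarTower k k[X] M] [FiniteDimensional k M] [AddCommGroup N] [Module k N] [Module k[X] N]
    [IsScalarTower k k[X] N] [FiniteDimensional k N] : FiniteDimensional k (M →ₗ[k[X]] N) :=
  FiniteDimensional.of_injective (LinearMap.restrictScalarsₗ k k[X] M N k)
    (LinearMap.restrictScalars_injective k)

/-- Composition with a morphism of embeddings. -/
noncomputable def Hom.precomp {Y Z : Embedding k} (φ : Y.B →ₗ[k[X]] Z.B) (hφ : φ ∈ Hom Y Z)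
    (W : Embedding k) : Hom Z W →ₗ[k] Hom Y W where
  toFun f := ⟨f.1.comp φ, fun a ha => f.2 _ (hφ a ha)⟩
  map_add' _ _ := rfl
  map_smul' _ _ := rfl

theorem Iso.finrank_hom_le {Y Z : Embedding k} (h : Iso Y Z) (W : Embedding k) :
    Module.finrank k (Hom Z W) ≤ Module.finrank k (Hom Y W) := by
  obtain ⟨f, hf⟩ := h
  refine LinearMap.finrank_le_finrank_of_injective
    (f := Hom.precomp f.toLinearMap (fun a ha => (hf a).1 ha) W) fun g g' hg => ?_
  refine Subtype.ext (LinearMap.ext fun z => ?_)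
  have := LinearMap.congr_fun (congrArg Subtype.val hg) (f.symm z)
  simpa [Hom.precomp] using this

theorem Iso.symm {Y Z : Embedding k} (h : Iso Y Z) : Iso Z Y := by
  obtain ⟨f, hf⟩ := h
  exact ⟨f.symm, fun b => by rw [hf]; simp⟩

theorem Iso.finrank_hom_eq {Y Z : Embedding k} (h : Iso Y Z) (W : Embedding k) :
    Module.finrank k (Hom Y W) = Module.finrank k (Hom Z W) :=
  le_antisymm (h.symm.finrank_hom_le W) (h.finrank_hom_le W)

theorem finrank_hom_add_le (U V W : Embedding k) :
    Module.finrank k (Hom U W) + Module.finrank k (Hom V W) ≤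
      Module.finrank k (Hom (U.directSum V) W) := by
  rw [← Module.finrank_prod]
  let φ : Hom U W × Hom V W →ₗ[k] Hom (U.directSum V) W :=
    { toFun := fun f => ⟨LinearMap.coprod f.1.1 f.2.1, fun a ha =>
        W.A.add_mem (f.1.2 _ ha.1) (f.2.2 _ ha.2)⟩
      map_add' := fun f g => Subtype.ext (LinearMap.ext fun x => by
        change (f.1.1 + g.1.1) x.1 + (f.2.1 + g.2.1) x.2 =
          (f.1.1 x.1 + f.2.1 x.2) + (g.1.1 x.1 + g.2.1 x.2)
        simp only [LinearMap.add_apply]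
        abel)
      map_smul' := fun c f => Subtype.ext (LinearMap.ext fun x => by
        change c • f.1.1 x.1 + c • f.2.1 x.2 = c • (f.1.1 x.1 + f.2.1 x.2)
        rw [smul_add]) }
  refine LinearMap.finrank_le_finrank_of_injective (f := φ) fun f g h => ?_
  have h' : ∀ x : U.B × V.B, f.1.1 x.1 + f.2.1 x.2 = g.1.1 x.1 + g.2.1 x.2 := fun x =>
    LinearMap.congr_fun (congrArg Subtype.val h) x
  refine Prod.ext (Subtype.ext (LinearMap.ext fun u => ?_))
    (Subtype.ext (LinearMap.ext fun v => ?_))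
  · simpa using h' (u, 0)
  · simpa using h' (0, v)

/-- Left exactness of `Hom(-, W)`: a morphism on `H` that vanishes on `U` factors through `V`. -/
theorem ShortExact.finrank_hom_le {U H V : Embedding k} (h : ShortExact U H V) (W : Embedding k) :
    Module.finrank k (Hom H W) ≤ Module.finrank k (Hom U W) + Module.finrank k (Hom V W) := by
  obtain ⟨f, hf, g, hg, -, hex, hsurj, -, hA⟩ := h
  rw [← (Hom.precomp f hf W).finrank_range_add_finrank_ker]
  refine add_le_add (Submodule.finrank_le _) ?_
  refine le_trans (Submodule.finrank_mono (t := LinearMap.range (Hom.precomp g hg W)) ?_)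
    (LinearMap.finrank_range_le _)
  intro φ hφ
  have hφ0 : ∀ u, φ.1 (f u) = 0 := fun u =>
    LinearMap.congr_fun (congrArg Subtype.val (LinearMap.mem_ker.1 hφ)) u
  have hker : LinearMap.ker g ≤ LinearMap.ker φ.1 := by
    intro x hx
    obtain ⟨u, rfl⟩ := (hex x).1 hx
    exact hφ0 u
  let ψ : V.B →ₗ[k[X]] W.B := ((LinearMap.ker g).liftQ φ.1 hker).comp
    (g.quotKerEquivOfSurjective hsurj).symm.toLinearMap
  have hψ : ∀ x, ψ (g x) = φ.1 x := by
    intro x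
    have : (g.quotKerEquivOfSurjective hsurj).symm (g x) = Submodule.Quotient.mk x := by
      rw [LinearEquiv.symm_apply_eq]
      rfl
    simp only [ψ, LinearMap.comp_apply, LinearEquiv.coe_coe, this]
    rfl
  -- The factorisation respects submodules because `A_H → A_V` is surjective; this is where
  -- exactness on the submodules enters.
  refine ⟨⟨ψ, fun a ha => ?_⟩, Subtype.ext (LinearMap.ext hψ)⟩
  obtain ⟨a', ha', rfl⟩ := hA a ha
  rw [hψ]
  exact φ.2 _ ha'

theorem Embedding.ExtLE.homLE {Y Z : Embedding k} (h : Y.ExtLE Z) : Y.HomLE Z := by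
  obtain ⟨s, H, U, V, h0, hstep, hs⟩ := h
  intro W
  rw [h0.finrank_hom_eq, hs.finrank_hom_eq]
  have : ∀ i ≤ s, Module.finrank k (Hom (H 0) W) ≤ Module.finrank k (Hom (H i) W) := by
    intro i hi
    induction i with
    | zero => exact le_rfl
    | succ i ih =>
      obtain ⟨h1, h2⟩ := hstep i (by omega)
      exact (ih (by omega)).trans ((h1.finrank_hom_le W).trans
        ((finrank_hom_add_le _ _ W).trans (h2.finrank_hom_eq W).le))
  exact this s le_rfl

/-! ### From homomorphisms to dominance -/

/-- Both sides count the cells in the first `c` rows, once by columns and once by rows. -/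
theorem sum_min_colLen (α : YoungDiagram) (c : ℕ) :
    ∑ j : Fin (α.rowLen 0), min (α.colLen j) c = ∑ i ∈ Finset.range c, α.rowLen i := by
  rw [Fin.sum_univ_eq_sum_range (fun j => min (α.colLen j) c)]
  have h1 : (α.cells.filter fun x => x.1 < c).card = ∑ i ∈ Finset.range c, α.rowLen i := by
    rw [Finset.card_eq_sum_card_fiberwise (f := Prod.fst) (t := Finset.range c)]
    · refine Finset.sum_congr rfl fun i hi => ?_
      rw [YoungDiagram.rowLen_eq_card]
      congr 1
      ext x
      simp only [Finset.mem_filter, YoungDiagram.mem_cells, YoungDiagram.mem_row_iff]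
      rw [Finset.mem_range] at hi
      constructor
      · exact fun h => ⟨h.1.1, h.2⟩
      · exact fun h => ⟨⟨h.1, by omega⟩, h.2⟩
    · intro x hx
      simpa using (Finset.mem_filter.1 (Finset.mem_coe.1 hx)).2
  rw [← h1, Finset.card_eq_sum_card_fiberwise (f := Prod.snd) (t := Finset.range (α.rowLen 0))]
  · refine Finset.sum_congr rfl fun j _ => ?_
    have : ((α.cells.filter fun x => x.1 < c).filter fun x => x.2 = j) =
        (Finset.range (min (α.colLen j) c)).image fun i => (i, j) := by
      ext ⟨i, j'⟩
      simp only [Finset.mem_filter, YoungDiagram.mem_cells, Finset.mem_image, Finset.mem_range,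
        lt_min_iff, Prod.mk.injEq]
      constructor
      · rintro ⟨⟨h2, h3⟩, rfl⟩
        exact ⟨i, ⟨YoungDiagram.mem_iff_lt_colLen.1 h2, h3⟩, rfl, rfl⟩
      · rintro ⟨i', ⟨h2, h3⟩, rfl, rfl⟩
        exact ⟨⟨YoungDiagram.mem_iff_lt_colLen.2 h2, h3⟩, rfl⟩
    rw [this, Finset.card_image_of_injective _ fun a b h => (Prod.mk.inj h).1, Finset.card_range]
  · rintro ⟨i, j⟩ h
    have h2 := (Finset.mem_filter.1 (Finset.mem_coe.1 h)).1
    simp only [Finset.coe_range, Set.mem_Iio]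
    rw [← YoungDiagram.mem_iff_lt_rowLen]
    exact α.up_left_mem (Nat.zero_le _) le_rfl h2

/-- Homomorphisms out of a cyclic module are given by elements annihilated by `X ^ l`. -/
noncomputable def cyclicHomEquiv (l : ℕ) (N : Type*) [AddCommGroup N] [Module k N] [Module k[X] N]
    [IsScalarTower k k[X] N] :
    ((k[X] ⧸ Ideal.span {(X ^ l : k[X])}) →ₗ[k[X]] N) ≃ₗ[k]
      LinearMap.ker ((LinearMap.lsmul k[X] N (X ^ l : k[X])).restrictScalars k) where
  toFun f := ⟨f 1, by
    simp only [LinearMap.mem_ker, LinearMap.coe_restrictScalars, LinearMap.lsmul_apply]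
    rw [← map_smul, smul_one_cyclic, map_zero]⟩
  map_add' _ _ := rfl
  map_smul' _ _ := rfl
  invFun x := Submodule.liftQSpanSingleton (X ^ l : k[X]) (LinearMap.toSpanSingleton k[X] N x.1)
    (by simpa using x.2)
  left_inv f := by
    refine LinearMap.ext fun y => ?_
    obtain ⟨p, rfl⟩ := Ideal.Quotient.mk_surjective y
    change p • f 1 = _
    rw [← map_smul, smul_one_quotient]
  right_inv x := by
    refine Subtype.ext ?_
    change (1 : k[X]) • x.1 = x.1
    rw [one_smul]

theorem finrank_cyclic_hom (l c : ℕ) :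
    Module.finrank k ((k[X] ⧸ Ideal.span {(X ^ l : k[X])}) →ₗ[k[X]]
      (k[X] ⧸ Ideal.span {(X ^ c : k[X])})) = min l c := by
  rw [(cyclicHomEquiv l _).finrank_eq]
  set μ := (LinearMap.lsmul k[X] (k[X] ⧸ Ideal.span {(X ^ c : k[X])}) (X ^ l : k[X])) with hμ
  have h1 := (μ.restrictScalars k).finrank_range_add_finrank_ker
  rw [finrank_cyclic] at h1
  let ν : k[X] →ₗ[k[X]] (k[X] ⧸ Ideal.span {(X ^ c : k[X])}) :=
    μ.comp (Submodule.mkQ _)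
  have hν : ∀ p, ν p = Ideal.Quotient.mk _ (X ^ l * p) := fun p => rfl
  have hker : LinearMap.ker ν = Ideal.span {(X ^ (c - l) : k[X])} := by
    ext p
    rw [LinearMap.mem_ker, hν, Ideal.Quotient.eq_zero_iff_mem, Ideal.mem_span_singleton,
      Ideal.mem_span_singleton]
    rcases le_total l c with h | h
    · obtain ⟨d, rfl⟩ := Nat.exists_eq_add_of_le h
      rw [pow_add, Nat.add_sub_cancel_left]
      exact mul_dvd_mul_iff_left (pow_ne_zero _ X_ne_zero)
    · rw [Nat.sub_eq_zero_of_le h, pow_zero]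
      simp only [isUnit_one, IsUnit.dvd, iff_true]
      exact (pow_dvd_pow _ h).mul_right _
  have hrange : LinearMap.range ν = LinearMap.range μ := by
    rw [LinearMap.range_comp, Submodule.range_mkQ, Submodule.map_top]
  have h2 : Module.finrank k (LinearMap.range (μ.restrictScalars k)) = c - l := by
    have e1 := (ν.quotKerEquivRange.restrictScalars k).finrank_eq
    rw [hrange, hker, finrank_cyclic] at e1
    rw [e1]
    rfl
  omega

/-- The embedding of the elements annihilated by `X ^ e` into `k[X] / (X ^ c)`. -/
noncomputable def cyclicEmbedding (k : Type u) [Field k] (e c : ℕ) : Embedding k where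
  B := k[X] ⧸ Ideal.span {(X ^ c : k[X])}
  nilpotent := ⟨c, fun b => by
    obtain ⟨p, rfl⟩ := Ideal.Quotient.mk_surjective b
    rw [← smul_one_quotient, smul_comm, smul_one_cyclic, smul_zero]⟩
  A := LinearMap.ker (LinearMap.lsmul k[X] _ (X ^ e : k[X]))

/-- `Hom(Y, (ker X ^ e ⊆ k[X] / (X ^ c))) = Hom(B / X ^ e A, k[X] / (X ^ c))`. -/
noncomputable def homCyclicEquiv (Y : Embedding k) (e c : ℕ) :
    Hom Y (cyclicEmbedding k e c) ≃ₗ[k]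
      ((Y.B ⧸ ((X ^ e : k[X]) • Y.A)) →ₗ[k[X]] (k[X] ⧸ Ideal.span {(X ^ c : k[X])})) where
  toFun f := Submodule.liftQ _ f.1 (by
    rintro _ ⟨a, ha, rfl⟩
    have := f.2 a ha
    change f.1 ((X ^ e : k[X]) • a) = 0
    exact (map_smul f.1 _ _).trans this)
  map_add' f g := by
    refine LinearMap.ext fun y => ?_
    obtain ⟨y, rfl⟩ := Submodule.Quotient.mk_surjective _ y
    rfl
  map_smul' c f := by
    refine LinearMap.ext fun y => ?_
    obtain ⟨y, rfl⟩ := Submodule.Quotient.mk_surjective _ y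
    rfl
  invFun g := ⟨g.comp (Submodule.mkQ _), fun a ha => by
    change (X ^ e : k[X]) • g (Submodule.Quotient.mk a) = 0
    rw [← map_smul, ← Submodule.Quotient.mk_smul,
      (Submodule.Quotient.mk_eq_zero _).2 (Submodule.smul_mem_pointwise_smul _ _ _ ha), map_zero]⟩
  left_inv f := rfl
  right_inv g := by
    refine LinearMap.ext fun y => ?_
    obtain ⟨y, rfl⟩ := Submodule.Quotient.mk_surjective _ y
    rfl

/-- Precomposition with an isomorphism, as a `k`-linear isomorphism. -/
noncomputable def precompEquiv {M M' : Type*} [AddCommGroup M] [Module k[X] M] [AddCommGroup M']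
    [Module k[X] M'] (f : M ≃ₗ[k[X]] M') (N : Type*) [AddCommGroup N] [Module k N] [Module k[X] N]
    [IsScalarTower k k[X] N] : (M →ₗ[k[X]] N) ≃ₗ[k] (M' →ₗ[k[X]] N) where
  toFun g := g.comp f.symm.toLinearMap
  map_add' _ _ := rfl
  map_smul' _ _ := rfl
  invFun g := g.comp f.toLinearMap
  left_inv g := by ext; simp
  right_inv g := by ext; simp

/-- The bridge from hom to dominance: the partial sums that define `NatLE` are Hom dimensions into
the test objects `cyclicEmbedding k e c`. -/
theorem finrank_hom_cyclic {Y : Embedding k} {e : ℕ} {α : YoungDiagram}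
    (h : Nonempty ((Y.B ⧸ ((X ^ e : k[X]) • Y.A)) ≃ₗ[k[X]] NilpModule k α)) (c : ℕ) :
    Module.finrank k (Hom Y (cyclicEmbedding k e c)) = ∑ i ∈ Finset.range c, α.rowLen i := by
  classical
  obtain ⟨f⟩ := h
  rw [(homCyclicEquiv Y e c).finrank_eq, (precompEquiv f _).finrank_eq,
    ← (LinearMap.lsum k[X] (fun j : Fin (α.rowLen 0) => k[X] ⧸ Ideal.span {(X ^ α.colLen j : k[X])})
      k).finrank_eq, Module.finrank_pi_fintype, ← sum_min_colLen]
  exact Finset.sum_congr rfl fun j _ => finrank_cyclic_hom _ _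

variable {r : ℕ} {β γ : YoungDiagram}

theorem ExtLE.homLE {Δ Γ : LRTableaux r β γ} (h : ExtLE k Δ Γ) : HomLE k Δ Γ :=
  Relation.ReflTransGen.mono
    (fun _ _ ⟨Y, Z, hY, hZ, hΔ, hΓ, hYZ⟩ => ⟨Y, Z, hY, hZ, hΔ, hΓ, hYZ.homLE⟩) _ _ h

theorem HomLE.domLE {Δ Γ : LRTableaux r β γ} (h : HomLE k Δ Γ) : DomLE Δ Γ := by
  induction h with
  | refl => exact fun i _ c => le_rfl
  | tail _ h ih =>
    obtain ⟨Y, Z, -, -, hΔ, hΓ, hYZ⟩ := h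
    refine fun i hi c => (ih i hi c).trans ?_
    have := hYZ (cyclicEmbedding k i c)
    rwa [finrank_hom_cyclic (hΔ i), finrank_hom_cyclic (hΓ i)] at this

end HomSpaces

end LRInv

namespace LRInv
open Polynomial
open scoped Pointwise

section Realization

variable {k : Type u} [Field k]

/-! ### Split ambient extensions -/

theorem Iso.refl (Y : Embedding k) : Iso Y Y := ⟨LinearEquiv.refl _ _, fun _ => Iff.rfl⟩

theorem Embedding.nilpotent_submodule (Y : Embedding k) (C : Submodule k[X] Y.B) :
    ∃ n : ℕ, ∀ b : C, (X ^ n : k[X]) • b = 0 := by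
  obtain ⟨n, hn⟩ := Y.nilpotent
  exact ⟨n, fun b => Subtype.ext (hn b.1)⟩

/-- The embedding with the same ambient module and another submodule. -/
def Embedding.withSub (Y : Embedding k) (A : Submodule k[X] Y.B) : Embedding k :=
  { Y with A := A }

/-- The embedding induced on a submodule of the ambient module. -/
noncomputable def Embedding.restrict (Y : Embedding k) (C A : Submodule k[X] Y.B) :
    Embedding k where
  B := C
  finite := FiniteDimensional.of_injective (C.subtype.restrictScalars k) C.injective_subtype
  nilpotent := Y.nilpotent_submodule C
  A := A.comap C.subtype

/-- If `π` is an idempotent endomorphism of the ambient module, `A = A₁ ⊕ (a)` with `π = 0` on `A₁`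
and `π a = a`, then `A₁ + (a')` with `π a' = a` has `A` as a degeneration by an extension. -/
theorem extLE_of_idempotent (Y : Embedding k) (π : Y.B →ₗ[k[X]] Y.B) (hπ : ∀ b, π (π b) = π b)
    (A₁ : Submodule k[X] Y.B) (a a' : Y.B) (hA₁ : ∀ b ∈ A₁, π b = 0) (ha : π a = a)
    (ha' : π a' = a)
    (hdim : Module.finrank k (A₁ ⊔ Submodule.span k[X] {a'} : Submodule k[X] Y.B) ≤
      Module.finrank k (A₁ ⊔ Submodule.span k[X] {a} : Submodule k[X] Y.B)) :
    (Y.withSub (A₁ ⊔ Submodule.span k[X] {a'})).ExtLE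
      (Y.withSub (A₁ ⊔ Submodule.span k[X] {a})) := by
  set A := A₁ ⊔ Submodule.span k[X] {a} with hA
  set A' := A₁ ⊔ Submodule.span k[X] {a'} with hA'
  have hmemA : ∀ b, b ∈ A → b - π b ∈ A₁ ∧ π b ∈ A := by
    intro b hb
    obtain ⟨x, hx, y, hy, rfl⟩ := Submodule.mem_sup.1 hb
    obtain ⟨p, rfl⟩ := Submodule.mem_span_singleton.1 hy
    rw [map_add, hA₁ x hx, map_smul, ha, zero_add, add_sub_cancel_right]
    exact ⟨hx, Submodule.mem_sup_right hy⟩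
  have hmap : A'.map π = A.map π := by
    have h0 : A₁.map π = ⊥ := by
      rw [eq_bot_iff]
      rintro _ ⟨x, hx, rfl⟩
      exact hA₁ x hx
    rw [hA, hA', Submodule.map_sup, Submodule.map_sup, Submodule.map_span, Submodule.map_span, h0,
      Set.image_singleton, Set.image_singleton, ha, ha']
  have hker : A ⊓ LinearMap.ker π = A' ⊓ LinearMap.ker π := by
    have hle : A ⊓ LinearMap.ker π ≤ A' ⊓ LinearMap.ker π := by
      intro b hb
      refine ⟨?_, hb.2⟩
      have h1 := (hmemA b hb.1).1
      rw [LinearMap.mem_ker.1 hb.2, sub_zero] at h1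
      exact Submodule.mem_sup_left h1
    -- Rank-nullity for `π` on `D`. The images of `A` and `A'` agree and `dim A' ≤ dim A`, so the
    -- inclusion of the kernels must be an equality.
    have hrank : ∀ D : Submodule k[X] Y.B, Module.finrank k D =
        Module.finrank k (D.map π) +
          Module.finrank k (D ⊓ LinearMap.ker π : Submodule k[X] Y.B) := by
      intro D
      have h1 := ((π.restrictScalars k).domRestrict
        (D.restrictScalars k)).finrank_range_add_finrank_ker
      have e1 : LinearMap.range ((π.restrictScalars k).domRestrict (D.restrictScalars k)) =
          (D.map π).restrictScalars k := by
        ext x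
        constructor
        · rintro ⟨y, rfl⟩
          exact ⟨y.1, y.2, rfl⟩
        · rintro ⟨y, hy, rfl⟩
          exact ⟨⟨y, hy⟩, rfl⟩
      have e2 : (LinearMap.ker ((π.restrictScalars k).domRestrict (D.restrictScalars k))).map
          (D.restrictScalars k).subtype = (D ⊓ LinearMap.ker π).restrictScalars k := by
        ext x
        constructor
        · rintro ⟨y, hy, rfl⟩
          exact ⟨y.2, hy⟩
        · rintro ⟨h2, h3⟩
          exact ⟨⟨x, h2⟩, h3, rfl⟩
      have h2 := (Submodule.equivMapOfInjective (D.restrictScalars k).subtype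
        (Submodule.injective_subtype _)
        (LinearMap.ker ((π.restrictScalars k).domRestrict (D.restrictScalars k)))).finrank_eq
      rw [e1, h2, e2] at h1
      exact h1.symm
    have hr1 := hrank A
    have hr2 := hrank A'
    rw [hmap] at hr2
    have hle' : (A ⊓ LinearMap.ker π).restrictScalars k ≤
        (A' ⊓ LinearMap.ker π).restrictScalars k := hle
    have heq := Submodule.eq_of_le_of_finrank_le hle' (by
      change Module.finrank k (A' ⊓ LinearMap.ker π : Submodule k[X] Y.B) ≤
        Module.finrank k (A ⊓ LinearMap.ker π : Submodule k[X] Y.B)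
      omega)
    exact Submodule.restrictScalars_injective k _ _ heq
  -- `A` and `A'` have the same intersection with `ker π` and the same image `A ∩ im π`. Both are
  -- thus extensions of the same two embeddings, and `A` is the split one.
  let U := Y.restrict (LinearMap.ker π) A
  let V := Y.restrict (LinearMap.range π) A
  refine ⟨1, fun i => if i = 0 then Y.withSub A' else Y.withSub A, fun _ => U, fun _ => V,
    Iso.refl _, fun i hi => ?_, Iso.refl _⟩
  obtain rfl : i = 0 := by omega
  change ShortExact U (Y.withSub A') V ∧ Iso (U.directSum V) (Y.withSub A)
  let ι := (LinearMap.ker π).subtype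
  let ρ := π.rangeRestrict
  let f : U.B →ₗ[k[X]] (Y.withSub A').B := ι
  let g : (Y.withSub A').B →ₗ[k[X]] V.B := ρ
  have hf : Function.Injective ι := Submodule.injective_subtype _
  have hg : Function.Surjective ρ := π.surjective_rangeRestrict
  refine ⟨⟨f, ?_, g, ?_, hf, ?_, hg, ?_, ?_⟩, ?_⟩
  · intro u hu
    have : u.1 ∈ A ⊓ LinearMap.ker π := ⟨hu, u.2⟩
    rw [hker] at this
    exact this.1
  · intro b hb
    change π b ∈ A
    have : π b ∈ A'.map π := ⟨b, hb, rfl⟩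
    rw [hmap] at this
    obtain ⟨x, hx, hxb⟩ := this
    rw [← hxb]
    exact (hmemA x hx).2
  · intro b
    constructor
    · intro h
      exact ⟨⟨b, congrArg Subtype.val h⟩, rfl⟩
    · rintro ⟨u, rfl⟩
      exact Subtype.ext u.2
  · intro b hb h
    have h0 : b ∈ LinearMap.ker π := congrArg Subtype.val h
    have : b ∈ A' ⊓ LinearMap.ker π := ⟨hb, h0⟩
    rw [← hker] at this
    exact ⟨⟨b, h0⟩, this.1, rfl⟩
  · rintro ⟨v, x, rfl⟩ hv
    have : π (π x) ∈ A.map π := ⟨π x, hv, rfl⟩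
    rw [hπ, ← hmap] at this
    obtain ⟨y, hy, hyx⟩ := this
    exact ⟨y, hy, Subtype.ext hyx⟩
  · let φ : (LinearMap.ker π × LinearMap.range π) ≃ₗ[k[X]] Y.B :=
      { toFun := fun x => x.1.1 + x.2.1
        map_add' := fun x y => by
          change (x.1.1 + y.1.1) + (x.2.1 + y.2.1) = _
          abel
        map_smul' := fun c x => (smul_add c x.1.1 x.2.1).symm
        invFun := fun b => (⟨b - π b, by rw [LinearMap.mem_ker, map_sub, hπ, sub_self]⟩,
          ⟨π b, b, rfl⟩)
        left_inv := by
          rintro ⟨⟨x, hx⟩, ⟨_, y, rfl⟩⟩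
          have h1 : π (x + π y) = π y := by
            rw [map_add, LinearMap.mem_ker.1 hx, zero_add, hπ]
          refine Prod.ext (Subtype.ext ?_) (Subtype.ext h1)
          change x + π y - π (x + π y) = x
          rw [h1, add_sub_cancel_right]
        right_inv := fun b => by
          change b - π b + π b = b
          rw [sub_add_cancel] }
    refine ⟨φ, ?_⟩
    rintro ⟨⟨x, hx⟩, ⟨_, y, rfl⟩⟩
    change (x ∈ A ∧ π y ∈ A) ↔ x + π y ∈ A
    constructor
    · exact fun h => A.add_mem h.1 h.2
    · intro h
      have h1 : π (x + π y) = π y := by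
        rw [map_add, LinearMap.mem_ker.1 hx, zero_add, hπ]
      have h2 := hmemA _ h
      rw [h1, add_sub_cancel_right] at h2
      exact ⟨Submodule.mem_sup_left h2.1, h2.2⟩

/-! ### Embeddings with a given tableau -/

variable {r : ℕ} {β γ : YoungDiagram}

/-- The ambient module `N_β` with the zero submodule. -/
noncomputable def ambient (k : Type u) [Field k] (β : YoungDiagram) : Embedding k where
  B := NilpModule k β
  nilpotent := ⟨β.colLen 0, fun b => funext fun j => by
    obtain ⟨p, hp⟩ := Ideal.Quotient.mk_surjective (b j)
    have h := Nat.exists_eq_add_of_le (β.colLen_anti 0 j (Nat.zero_le _))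
    obtain ⟨d, hd⟩ := h
    change (X ^ β.colLen 0 : k[X]) • b j = 0
    rw [← hp, ← smul_one_quotient, smul_comm, hd, pow_add, mul_comm, mul_smul, smul_one_cyclic,
      smul_zero, smul_zero]⟩
  A := ⊥

/-- The embedding of a submodule of `N_β`. -/
noncomputable def nilpEmbedding (A : Submodule k[X] (NilpModule k β)) : Embedding k :=
  (ambient k β).withSub A

/-- The generator of the `j`-th summand of `N_β`. -/
noncomputable def colGen (k : Type u) [Field k] (β : YoungDiagram) (j : ℕ) : NilpModule k β :=
  if h : j < β.rowLen 0 then Pi.single ⟨j, h⟩ 1 else 0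

theorem smul_colGen (j : ℕ) : (X ^ β.colLen j : k[X]) • colGen k β j = 0 := by
  unfold colGen
  split_ifs with h
  · rw [← Pi.single_smul]
    exact Pi.single_eq_zero_iff.2 (smul_one_cyclic _)
  · exact smul_zero _

theorem span_colGen : Submodule.span k[X] (Set.range (colGen k β)) = ⊤ := by
  rw [eq_top_iff, ← span_single_cyclic (k := k) fun j : Fin (β.rowLen 0) => β.colLen j,
    Submodule.span_le]
  rintro _ ⟨j, rfl⟩
  exact Submodule.subset_span ⟨j, by simp [colGen]⟩

/-- The generator of the summand of `N_β` given by the column of the cell in row `i` of the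
rook strip `β ∖ γ`. -/
noncomputable def rowGen (k : Type u) [Field k] (β γ : YoungDiagram) (i : ℕ) : NilpModule k β :=
  if i ∈ stripRows β γ then colGen k β (γ.rowLen i) else 0

theorem smul_rowGen (hR : IsRookStrip β γ) {i n : ℕ} (h : i < n) :
    (X ^ n : k[X]) • rowGen k β γ i = 0 := by
  unfold rowGen
  split_ifs with hi
  · obtain ⟨d, rfl⟩ := Nat.exists_eq_add_of_le (Nat.succ_le_of_lt h)
    rw [Nat.succ_eq_add_one, ← colLen_rowLen hR hi, pow_add, mul_comm, mul_smul, smul_colGen,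
      smul_zero]
  · exact smul_zero _

/-- The submodule generated by the elements `X ^ i • Eᵢ'` with `i' > i`. -/
noncomputable def tail (k : Type u) [Field k] (β γ : YoungDiagram) (i : ℕ) :
    Submodule k[X] (NilpModule k β) :=
  Submodule.span k[X] ((fun i' => (X ^ i : k[X]) • rowGen k β γ i') '' Set.Ioi i)

theorem smul_rowGen_mem_tail {i i' n : ℕ} (h : i < i') (hn : i ≤ n) :
    (X ^ n : k[X]) • rowGen k β γ i' ∈ tail k β γ i := by
  obtain ⟨d, rfl⟩ := Nat.exists_eq_add_of_le hn
  rw [pow_add, mul_comm, mul_smul]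
  exact Submodule.smul_mem _ _ (Submodule.subset_span ⟨i', h, rfl⟩)

/-- An element of `A` of the form `X ^ i • Eᵢ` plus tail is `X ^ i • f` with `f` equal to `Eᵢ` plus
later generators. Replacing `Eᵢ` by `f` is a unitriangular change of generators, and modulo `A` the
relation `X ^ (i + 1) • f = 0` improves to `X ^ i • f = 0`. This removes the strip cell of row `i`
from its column, and the dimension bound rules out further relations. -/
theorem nonempty_quotient_equiv (hR : IsRookStrip β γ) (Γ : LRTableaux r β γ)
    (A : Submodule k[X] (NilpModule k β)) (e : ℕ)
    (hw : ∀ i ∈ stripRows β γ, e < rowWord γ Γ.1 i →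
      ∃ w ∈ A, w - (X ^ i : k[X]) • rowGen k β γ i ∈ tail k β γ i)
    (hdim : Module.finrank k A ≤ ((stripRows β γ).filter fun i => e < rowWord γ Γ.1 i).card) :
    Nonempty ((NilpModule k β ⧸ A) ≃ₗ[k[X]] NilpModule k (level Γ e)) := by
  classical
  -- modified generators
  have hf : ∀ i, ∃ f : NilpModule k β, (i ∈ stripRows β γ → e < rowWord γ Γ.1 i →
      (X ^ i : k[X]) • f ∈ A) ∧ (i ∈ stripRows β γ → ¬ e < rowWord γ Γ.1 i → f = rowGen k β γ i) ∧
      f - rowGen k β γ i ∈ Submodule.span k[X] (rowGen k β γ '' Set.Ioi i) := by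
    intro i
    by_cases hi : i ∈ stripRows β γ ∧ e < rowWord γ Γ.1 i
    · obtain ⟨w, hwA, hwt⟩ := hw i hi.1 hi.2
      have htail : tail k β γ i =
          (X ^ i : k[X]) • Submodule.span k[X] (rowGen k β γ '' Set.Ioi i) := by
        rw [Submodule.smul_span, tail, ← Set.image_smul, Set.image_image]
      rw [htail, Submodule.mem_smul_pointwise_iff_exists] at hwt
      obtain ⟨g, hg, hgw⟩ := hwt
      refine ⟨rowGen k β γ i + g, fun _ _ => ?_, fun _ h => absurd hi.2 h, by simpa using hg⟩
      rw [smul_add, hgw, add_sub_cancel]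
      exact hwA
    · exact ⟨rowGen k β γ i, fun h1 h2 => absurd ⟨h1, h2⟩ hi, fun _ _ => rfl, by simp⟩
  choose f hfA hfeq hfspan using hf
  let g : ℕ → NilpModule k β := fun j =>
    if h : ∃ i ∈ stripRows β γ, γ.rowLen i = j then f h.choose else colGen k β j
  have hg1 : ∀ i ∈ stripRows β γ, g (γ.rowLen i) = f i := by
    intro i hi
    have h : ∃ i' ∈ stripRows β γ, γ.rowLen i' = γ.rowLen i := ⟨i, hi, rfl⟩
    simp only [g, dif_pos h]
    rw [rowLen_injOn hR h.choose_spec.1 hi h.choose_spec.2]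
  have hg2 : ∀ j, (¬ ∃ i ∈ stripRows β γ, γ.rowLen i = j) → g j = colGen k β j := by
    intro j h
    simp only [g, dif_neg h]
  have hspan : Submodule.span k[X] (Set.range g) = ⊤ := by
    -- Downward induction on `i`, since `f i` differs from `Eᵢ` only by generators of lower rows.
    have hrow : ∀ i, rowGen k β γ i ∈ Submodule.span k[X] (Set.range g) := by
      obtain ⟨N, hN⟩ : ∃ N, ∀ i ∈ stripRows β γ, i < N :=
        ⟨(stripRows β γ).sup id + 1, fun i hi => by
          have := Finset.le_sup (f := id) hi
          simp only [id] at this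
          omega⟩
      intro i
      induction hd : N - i using Nat.strong_induction_on generalizing i with
      | _ d ih =>
        by_cases hi : i ∈ stripRows β γ
        · have h1 : Submodule.span k[X] (rowGen k β γ '' Set.Ioi i) ≤
              Submodule.span k[X] (Set.range g) := by
            rw [Submodule.span_le]
            rintro _ ⟨i', hi', rfl⟩
            have := hN i hi
            rw [Set.mem_Ioi] at hi'
            exact ih (N - i') (by omega) i' rfl
          have h2 := h1 (hfspan i)
          have h3 : f i ∈ Submodule.span k[X] (Set.range g) :=
            Submodule.subset_span ⟨_, hg1 i hi⟩
          have := Submodule.sub_mem _ h3 h2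
          rwa [sub_sub_cancel] at this
        · rw [rowGen, if_neg hi]
          exact Submodule.zero_mem _
    rw [eq_top_iff, ← span_colGen (k := k), Submodule.span_le]
    rintro _ ⟨j, rfl⟩
    by_cases h : ∃ i ∈ stripRows β γ, γ.rowLen i = j
    · obtain ⟨i, hi, rfl⟩ := h
      have := hrow i
      rwa [rowGen, if_pos hi] at this
    · exact Submodule.subset_span ⟨j, hg2 j h⟩
  have hle : ∀ i j, (i, j) ∈ β → Γ.1 (i, j) ≤ e → i < (level Γ e).colLen j := by
    intro i j h h'
    rw [← YoungDiagram.mem_iff_lt_colLen, mem_level]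
    exact ⟨h, h'⟩
  have hzero : ∀ c, c ∉ β.cells \ γ.cells → Γ.1 c = 0 := by
    obtain ⟨α, -, h⟩ := Γ.2
    exact h.eq_zero
  have hkill : ∀ (n m : ℕ) (x : NilpModule k β), m ≤ n → (X ^ m : k[X]) • x ∈ A →
      (X ^ n : k[X]) • x ∈ A := by
    intro n m x hmn h
    obtain ⟨d, rfl⟩ := Nat.exists_eq_add_of_le hmn
    rw [pow_add, mul_comm, mul_smul]
    exact A.smul_mem _ h
  have hcol : ∀ j, (∀ i, (i, j) ∈ β → Γ.1 (i, j) ≤ e) →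
      β.colLen j ≤ (level Γ e).colLen j := by
    intro j h
    by_contra! hc
    have := hle _ j (YoungDiagram.mem_iff_lt_colLen.2 hc)
      (h _ (YoungDiagram.mem_iff_lt_colLen.2 hc))
    omega
  have hfd : FiniteDimensional k (NilpModule k β ⧸ A) :=
    FiniteDimensional.of_surjective ((Submodule.mkQ A).restrictScalars k)
      (Submodule.mkQ_surjective A)
  refine nonempty_equiv_nilpModule (level Γ e) (fun j => Submodule.Quotient.mk (g j))
    (fun j => ?_) ?_ ?_
  · rw [← Submodule.Quotient.mk_smul, Submodule.Quotient.mk_eq_zero]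
    by_cases h : ∃ i ∈ stripRows β γ, γ.rowLen i = j
    · obtain ⟨i, hi, rfl⟩ := h
      rw [hg1 i hi]
      by_cases he : e < rowWord γ Γ.1 i
      · refine hkill _ i _ ?_ (hfA i hi he)
        -- The column of `γ⁽ᵉ⁾` through this cell has length at least `i`, because all cells above
        -- the strip cell belong to `γ`.
        by_contra! hc
        have h1 : ((level Γ e).colLen (γ.rowLen i), γ.rowLen i) ∈ γ := by
          rw [YoungDiagram.mem_iff_lt_rowLen]
          exact rowLen_lt_of_lt hR hi hc
        have := hle _ _ (hR.1.1 h1) (by rw [hzero _ (by simp [h1])]; exact Nat.zero_le _)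
        omega
      · rw [hfeq i hi he, rowGen, if_pos hi]
        refine hkill _ _ _ (hcol _ fun i' hi' => ?_) (by rw [smul_colGen]; exact A.zero_mem)
        by_cases hγ : (i', γ.rowLen i) ∈ γ
        · rw [hzero _ (by simp [hγ])]; exact Nat.zero_le _
        · have hc : (i', γ.rowLen i) ∈ β.cells \ γ.cells := by simp [hi', hγ]
          have h2 := eq_rowLen_of_mem_strip hR hc
          obtain rfl := rowLen_injOn hR hi (Finset.mem_image.2 ⟨_, hc, rfl⟩) h2
          exact not_lt.1 he
    · rw [hg2 j h]
      refine hkill _ _ _ (hcol _ fun i' hi' => ?_) (by rw [smul_colGen]; exact A.zero_mem)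
      by_cases hγ : (i', j) ∈ γ
      · rw [hzero _ (by simp [hγ])]; exact Nat.zero_le _
      · have hc : (i', j) ∈ β.cells \ γ.cells := by simp [hi', hγ]
        exact absurd ⟨i', Finset.mem_image.2 ⟨_, hc, rfl⟩,
          (eq_rowLen_of_mem_strip hR hc).symm⟩ h
  · have h1 := congrArg (Submodule.map A.mkQ) hspan
    rw [Submodule.map_span, Submodule.map_top, Submodule.range_mkQ, ← Set.range_comp] at h1
    exact h1
  · have h1 := level_card hR Γ e
    have h2 := (A.restrictScalars k).finrank_quotient_add_finrank
    have h3 : Module.finrank k (NilpModule k β ⧸ A.restrictScalars k) =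
      Module.finrank k (NilpModule k β ⧸ A) := rfl
    have h4 : Module.finrank k (A.restrictScalars k) = Module.finrank k A := rfl
    rw [finrank_nilpModule, h3, h4] at h2
    omega

/-- A criterion for an embedding to have a given tableau. -/
theorem realizes (hR : IsRookStrip β γ) (hw : β.card = γ.card + r) (Γ : LRTableaux r β γ)
    (a w : ℕ → NilpModule k β)
    (hwA : ∀ i ∈ stripRows β γ, w i ∈
      (X ^ (rowWord γ Γ.1 i - 1) : k[X]) • Submodule.span k[X] (Set.range a))
    (hwt : ∀ i ∈ stripRows β γ, w i - (X ^ i : k[X]) • rowGen k β γ i ∈ tail k β γ i)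
    (ha : ∀ l s, (X ^ l : k[X]) • a s ∈ Submodule.span k
      (w '' {i | i ∈ stripRows β γ ∧ l < rowWord γ Γ.1 i})) :
    InCategory r β γ (nilpEmbedding (Submodule.span k[X] (Set.range a))) ∧
      HasTableau (nilpEmbedding (Submodule.span k[X] (Set.range a))) Γ := by
  classical
  set A := Submodule.span k[X] (Set.range a) with hA
  have htab : ∀ e, Nonempty ((NilpModule k β ⧸ ((X ^ e : k[X]) • A)) ≃ₗ[k[X]]
      NilpModule k (level Γ e)) := by
    intro e
    refine nonempty_quotient_equiv hR Γ _ e (fun i hi he => ⟨w i, ?_, hwt i hi⟩) ?_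
    · obtain ⟨x, hx, hxw⟩ := (Submodule.mem_smul_pointwise_iff_exists _ _ _).1 (hwA i hi)
      rw [← hxw, show rowWord γ Γ.1 i - 1 = e + (rowWord γ Γ.1 i - 1 - e) by omega, pow_add,
        mul_smul]
      exact Submodule.smul_mem_pointwise_smul _ _ _ (A.smul_mem _ hx)
    · let F := ((stripRows β γ).filter fun i => e < rowWord γ Γ.1 i)
      have hle : ((X ^ e : k[X]) • A).restrictScalars k ≤
          Submodule.span k ((F.image w : Finset _) : Set (NilpModule k β)) := by
        have hset : ((F.image w : Finset _) : Set (NilpModule k β)) =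
            w '' {i | i ∈ stripRows β γ ∧ e < rowWord γ Γ.1 i} := by
          simp [F]
        rw [hset]
        rintro _ ⟨x, hx, rfl⟩
        change (X ^ e : k[X]) • x ∈ _
        -- Allowing every exponent `l ≥ e` makes the claim stable under multiplication by
        -- polynomials, so it need only be checked on generators.
        suffices h : ∀ l, e ≤ l → (X ^ l : k[X]) • x ∈ Submodule.span k
            (w '' {i | i ∈ stripRows β γ ∧ e < rowWord γ Γ.1 i}) from h e le_rfl
        rw [SetLike.mem_coe, hA] at hx
        induction hx using Submodule.span_induction with
        | mem x hx =>
          obtain ⟨s, rfl⟩ := hx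
          intro l hl
          refine Submodule.span_mono (Set.image_mono fun i hi => ?_) (ha l s)
          exact ⟨hi.1, lt_of_le_of_lt hl hi.2⟩
        | zero => intro l _; rw [smul_zero]; exact Submodule.zero_mem _
        | add x y _ _ hx hy =>
          intro l hl
          rw [smul_add]
          exact Submodule.add_mem _ (hx l hl) (hy l hl)
        | smul p x _ hx =>
          intro l hl
          induction p using Polynomial.induction_on' with
          | add p q hp hq => rw [add_smul, smul_add]; exact Submodule.add_mem _ hp hq
          | monomial n c =>
            rw [← mul_smul, ← C_mul_X_pow_eq_monomial, ← smul_eq_C_mul, mul_smul_comm, ← pow_add,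
              smul_assoc]
            exact Submodule.smul_mem _ _ (hx (l + n) (by omega))
      have h1 := Submodule.finrank_mono hle
      exact h1.trans ((finrank_span_finset_le_card _).trans Finset.card_image_le)
  have h0 : level Γ 0 = γ := by
    refine YoungDiagram.ext (Finset.ext fun c => ?_)
    obtain ⟨α, -, h⟩ := Γ.2
    rw [YoungDiagram.mem_cells, YoungDiagram.mem_cells, mem_level]
    constructor
    · rintro ⟨h1, h2⟩
      by_contra h3
      have := h.pos c (by simp [h1, h3])
      omega
    · intro h1
      exact ⟨hR.1.1 h1, (h.eq_zero c (by simp [h1])).le⟩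
  have hγ : Nonempty ((NilpModule k β ⧸ A) ≃ₗ[k[X]] NilpModule k γ) := by
    have := htab 0
    rwa [pow_zero, one_smul, h0] at this
  refine ⟨⟨⟨LinearEquiv.refl _ _⟩, hγ, ?_⟩, htab⟩
  have hfd : FiniteDimensional k A :=
    FiniteDimensional.of_injective (A.subtype.restrictScalars k) A.injective_subtype
  obtain ⟨n, hn⟩ := (ambient k β).nilpotent
  -- The isomorphism type of `A` exists by the structure theorem; its weight is read off from the
  -- dimensions of `N_β` and the quotient.
  obtain ⟨α, hα, hα'⟩ := exists_equiv_nilpModule (k := k) A ⟨n, fun b => Subtype.ext (hn b.1)⟩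
  refine ⟨α, ?_, hα'⟩
  obtain ⟨φ⟩ := hγ
  have h1 := (φ.restrictScalars k).finrank_eq
  have h2 := (A.restrictScalars k).finrank_quotient_add_finrank
  have h3 : Module.finrank k (NilpModule k β ⧸ A.restrictScalars k) =
    Module.finrank k (NilpModule k β ⧸ A) := rfl
  have h4 : Module.finrank k (A.restrictScalars k) = Module.finrank k A := rfl
  rw [finrank_nilpModule, h3, h4] at h2
  rw [finrank_nilpModule] at h1
  omega

end Realization

end LRInv

namespace LRInv
open Polynomial
open scoped Pointwise

/-! ### Column structure of a lowering -/

/-- This is the lattice condition of the lowered word just after `p`. It says that the chain with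
index `letterCount W b p` already contains a `b - 1` before `p`, so `p` can continue it as a letter
`b`. -/
theorem IsLowering.letterCount_lt_pred {W : ℕ → ℕ} {p b : ℕ} (h : IsLowering W p b) :
    letterCount W b p < letterCount W (b - 1) p := by
  have hpos := h.pos
  have hlt := h.lt
  have h1 := h.lattice_lower (p + 1) (b - 1) (by omega)
  rw [Nat.sub_add_cancel (by omega)] at h1
  have h0 : letterCount W b (p + 1) = letterCount W b p := by
    rw [letterCount_succ, if_neg hlt.ne, add_zero]
  have h2 := letterCount_lower W hlt.ne b (p + 1)
  have h3 := letterCount_lower W hlt.ne (b - 1) (p + 1)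
  have h4 := letterCount_succ W (b - 1) p
  simp only [h0, lt_add_one, true_and, hlt.ne, if_false, if_true] at h2 h3
  rw [if_neg (show ¬ b = b - 1 by omega)] at h3
  omega

theorem IsLowering.exists_pred {W : ℕ → ℕ} {p b : ℕ} (h : IsLowering W p b) :
    ∃ i < p, W i = b - 1 ∧ colIndex W i = letterCount W b p := by
  obtain ⟨i, hi, hW, hc⟩ := exists_of_lt_letterCount h.letterCount_lt_pred
  exact ⟨i, hi, hW, by rw [colIndex, hW, hc]⟩

theorem IsLowering.letterCount_lt_colIndex {W : ℕ → ℕ} {p b : ℕ} (h : IsLowering W p b) :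
    letterCount W b p < colIndex W p := by
  have hpos := h.pos
  have hlt := h.lt
  exact h.letterCount_lt_pred.trans_le (h.lattice.letterCount_anti h.pos (by omega) p)

theorem IsNext.colIndex {W : ℕ → ℕ} {p b i : ℕ} (h : IsNext W p b i) :
    colIndex W i = letterCount W b p := by
  rw [LRInv.colIndex, h.2.1, h.2.2]

theorem IsLowering.isNext_iff {W : ℕ → ℕ} {p b : ℕ} (h : IsLowering W p b) {i : ℕ} :
    IsNext W p b i ↔ W i = b ∧ colIndex W i = letterCount W b p := by
  constructor
  · exact fun hi => ⟨hi.2.1, hi.colIndex⟩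
  · rintro ⟨h1, h2⟩
    rw [LRInv.colIndex, h1] at h2
    refine ⟨?_, h1, h2⟩
    by_contra! hip
    rcases hip.lt_or_eq with h3 | h3
    · have := letterCount_lt h1 h3
      omega
    · have := h.lt
      rw [h3] at h1
      omega

/-- If the chain of `p` continues, its letter `W p + 1` cannot come before the next `b` by the gap
condition. Nor can it be that `b`, because the chain of the next `b` has smaller index than the
chain of `p`. Hence a next `b` exists and precedes the rest of the chain of `p`. -/
theorem IsLowering.exists_next {W : ℕ → ℕ} {p b : ℕ} (h : IsLowering W p b) {i : ℕ}
    (hc : colIndex W i = colIndex W p) (hi : W p < W i) :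
    ∃ j, IsNext W p b j ∧ j + (W i - W p) ≤ i := by
  have hpos := h.pos
  have hlt := h.lt
  obtain ⟨i₀, h₀, hW₀, hc₀⟩ := h.lattice.exists_above (l := W p + 1) (by omega)
    (W i - (W p + 1)) i (by omega)
  have hpi : p < i₀ := by
    have := h.lattice.add_sub_le (i := p) (i' := i₀) h.pos (by omega) (by rw [hc₀, hc])
    omega
  have hlc : letterCount W b p < letterCount W b i₀ := by
    by_contra! hle
    have heq := le_antisymm hle (letterCount_mono W b hpi.le)
    have h1 := h.gap i₀ hpi heq
    have h2 : W p + 1 = b := by omega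
    have h3 : colIndex W i₀ = letterCount W b p := by
      rw [LRInv.colIndex, hW₀, h2, heq]
    have h4 := h.letterCount_lt_colIndex
    omega
  obtain ⟨j, hj, hWj, hcj⟩ := exists_of_lt_letterCount hlc
  refine ⟨j, h.isNext_iff.2 ⟨hWj, by rw [LRInv.colIndex, hWj, hcj]⟩, by omega⟩

section Chains

variable {k : Type u} [Field k] {r : ℕ} {β γ : YoungDiagram}

/-! ### Chain generators -/

/-- The generator belonging to the `q`-th chain `1, 2, 3, …` of letters of the word `W`. -/
noncomputable def chainGen (k : Type u) [Field k] (β γ : YoungDiagram) (W : ℕ → ℕ) (q : ℕ) :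
    NilpModule k β :=
  ∑ i ∈ (stripRows β γ).filter fun i => colIndex W i = q,
    (X ^ (i + 1 - W i) : k[X]) • rowGen k β γ i

/-- Since `Eᵢ` is killed by `X ^ (i + 1)`, the exponent `i + 1 - W i` lets the summand of `i`
survive exactly `W i - 1` multiplications by `X`, its last multiple being `X ^ i • Eᵢ`. -/
theorem smul_chainGen (hR : IsRookStrip β γ) {W : ℕ → ℕ} (hW : IsLattice W) (l q : ℕ) :
    (X ^ l : k[X]) • chainGen k β γ W q =
      ∑ i ∈ (stripRows β γ).filter fun i => colIndex W i = q ∧ l < W i,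
        (X ^ (i + 1 + l - W i) : k[X]) • rowGen k β γ i := by
  rw [chainGen, Finset.smul_sum, ← Finset.filter_filter, Finset.sum_filter (fun i => l < W i)]
  refine Finset.sum_congr rfl fun i _ => ?_
  have h1 := hW.le_succ i
  rw [← mul_smul, ← pow_add]
  split_ifs with h
  · congr 2
    omega
  · exact smul_rowGen hR (by omega)

theorem smul_chainGen_eq_zero (hR : IsRookStrip β γ) {W : ℕ → ℕ} (hW : IsLattice W) {l q : ℕ}
    (h : ∀ i, colIndex W i = q → W i ≤ l) : (X ^ l : k[X]) • chainGen k β γ W q = 0 := by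
  rw [smul_chainGen hR hW]
  refine Finset.sum_eq_zero fun i hi => ?_
  obtain ⟨-, h1, h2⟩ := Finset.mem_filter.1 hi
  exact absurd (h i h1) (by omega)

theorem smul_chainGen_mem_tail (hR : IsRookStrip β γ) {W : ℕ → ℕ} (hW : IsLattice W) {l q n : ℕ}
    (h : ∀ i, colIndex W i = q → l < W i → n < i ∧ n + W i ≤ i + 1 + l) :
    (X ^ l : k[X]) • chainGen k β γ W q ∈ tail k β γ n := by
  rw [smul_chainGen hR hW]
  refine Submodule.sum_mem _ fun i hi => ?_
  obtain ⟨-, h1, h2⟩ := Finset.mem_filter.1 hi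
  obtain ⟨h3, h4⟩ := h i h1 h2
  exact smul_rowGen_mem_tail h3 (by omega)

theorem smul_chainGen_sub (hR : IsRookStrip β γ) {W : ℕ → ℕ} (hW : IsLattice W)
    {i₀ l : ℕ} (hi₀ : i₀ ∈ stripRows β γ) (hl : W i₀ = l + 1) :
    (X ^ l : k[X]) • chainGen k β γ W (colIndex W i₀) - (X ^ i₀ : k[X]) • rowGen k β γ i₀ =
      ∑ i ∈ (stripRows β γ).filter fun i => colIndex W i = colIndex W i₀ ∧ l + 1 < W i,
        (X ^ (i + 1 + l - W i) : k[X]) • rowGen k β γ i := by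
  have hset : ((stripRows β γ).filter fun i => colIndex W i = colIndex W i₀ ∧ l < W i) =
      insert i₀ ((stripRows β γ).filter fun i => colIndex W i = colIndex W i₀ ∧ l + 1 < W i) := by
    ext i
    simp only [Finset.mem_filter, Finset.mem_insert]
    constructor
    · rintro ⟨h1, h2, h3⟩
      by_cases h4 : W i = l + 1
      · exact Or.inl (eq_of_colIndex_eq (h4.trans hl.symm) h2)
      · exact Or.inr ⟨h1, h2, by omega⟩
    · rintro (rfl | ⟨h1, h2, h3⟩)
      · exact ⟨hi₀, rfl, by omega⟩
      · exact ⟨h1, h2, by omega⟩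
  rw [smul_chainGen hR hW, hset, Finset.sum_insert (by simp [hl]),
    show i₀ + 1 + l - W i₀ = i₀ by omega, add_sub_cancel_left]

theorem smul_chainGen_sub_mem_tail (hR : IsRookStrip β γ) {W : ℕ → ℕ} (hW : IsLattice W)
    {i₀ l n : ℕ} (hi₀ : i₀ ∈ stripRows β γ) (hl : W i₀ = l + 1)
    (h : ∀ i, colIndex W i = colIndex W i₀ → l + 1 < W i → n < i ∧ n + W i ≤ i + 1 + l) :
    (X ^ l : k[X]) • chainGen k β γ W (colIndex W i₀) - (X ^ i₀ : k[X]) • rowGen k β γ i₀ ∈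
      tail k β γ n := by
  rw [smul_chainGen_sub hR hW hi₀ hl]
  refine Submodule.sum_mem _ fun i hi => ?_
  obtain ⟨-, h1, h2⟩ := Finset.mem_filter.1 hi
  obtain ⟨h3, h4⟩ := h i h1 h2
  exact smul_rowGen_mem_tail h3 (by omega)

/-- Along a chain the position grows at least as fast as the letter, so the surviving later summands
have exponent at least `i`. -/
theorem smul_chainGen_self_sub_mem_tail (hR : IsRookStrip β γ) {W : ℕ → ℕ} (hW : IsLattice W)
    {i : ℕ} (hi : i ∈ stripRows β γ) (h1 : 1 ≤ W i) :
    (X ^ (W i - 1) : k[X]) • chainGen k β γ W (colIndex W i) - (X ^ i : k[X]) • rowGen k β γ i ∈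
      tail k β γ i := by
  refine smul_chainGen_sub_mem_tail hR hW hi (by omega) fun i' hc hlt => ?_
  have := hW.add_sub_le h1 (show W i ≤ W i' by omega) hc.symm
  omega

/-- The embedding given by the chains of the row word of `Γ` has tableau `Γ`. -/
theorem realizes_chainGen (k : Type u) [Field k] (hR : IsRookStrip β γ)
    (hw : β.card = γ.card + r) (Γ : LRTableaux r β γ) :
    InCategory r β γ (nilpEmbedding
        (Submodule.span k[X] (Set.range (chainGen k β γ (rowWord γ Γ.1))))) ∧
      HasTableau (nilpEmbedding
        (Submodule.span k[X] (Set.range (chainGen k β γ (rowWord γ Γ.1))))) Γ := by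
  set W := rowWord γ Γ.1 with hWdef
  have hW : IsLattice W := isLattice_rowWord hR Γ
  have hs : ∀ i, W i ≠ 0 ↔ i ∈ stripRows β γ := rowWord_ne_zero_iff hR Γ
  refine realizes hR hw Γ (chainGen k β γ W)
    (fun i => (X ^ (W i - 1) : k[X]) • chainGen k β γ W (colIndex W i)) (fun i _ => ?_)
    (fun i hi => ?_) fun l s => ?_
  · exact Submodule.smul_mem_pointwise_smul _ _ _ (Submodule.subset_span ⟨_, rfl⟩)
  · exact smul_chainGen_self_sub_mem_tail hR hW hi (Nat.one_le_iff_ne_zero.2 ((hs i).2 hi))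
  -- If the chain `s` has a letter `l + 1`, then `X ^ l • a s` is the chosen element of that
  -- position; otherwise all letters of the chain are at most `l` and the multiple is zero.
  · by_cases h : ∃ i, W i = l + 1 ∧ colIndex W i = s
    · obtain ⟨i, hi, rfl⟩ := h
      refine Submodule.subset_span ⟨i, ⟨(hs i).1 (by omega), by rw [← hWdef, hi]; omega⟩, ?_⟩
      simp [hi]
    · rw [smul_chainGen_eq_zero hR hW]
      · exact Submodule.zero_mem _
      · intro i hi
        by_contra! hlt
        obtain ⟨i₀, -, h1, h2⟩ := hW.exists_above (l := l + 1) (by omega) (W i - (l + 1)) i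
          (by omega)
        exact h ⟨i₀, h1, h2.trans hi⟩

/-! ### The deformed embedding -/

/-- The chain generators of `W`, where the generator of the chain to be continued by the position
`p` is modified. -/
noncomputable def lowerGen (k : Type u) [Field k] (β γ : YoungDiagram) (W : ℕ → ℕ) (p b q : ℕ) :
    NilpModule k β :=
  chainGen k β γ W q +
    if q = letterCount W b p then (X ^ (p + 1 - b) : k[X]) • rowGen k β γ p else 0

theorem lowerGen_of_ne {W : ℕ → ℕ} {p b q : ℕ} (h : q ≠ letterCount W b p) :
    lowerGen k β γ W p b q = chainGen k β γ W q := by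
  rw [lowerGen, if_neg h, add_zero]

theorem smul_lowerGen {W : ℕ → ℕ} {p b : ℕ} (h : b ≤ p + 1) (l : ℕ) :
    (X ^ l : k[X]) • lowerGen k β γ W p b (letterCount W b p) =
      (X ^ l : k[X]) • chainGen k β γ W (letterCount W b p) +
        (X ^ (p + 1 + l - b) : k[X]) • rowGen k β γ p := by
  rw [lowerGen, if_pos rfl, smul_add, ← mul_smul, ← pow_add]
  congr 3
  omega

/-- The deformed embedding has the lowered tableau. -/
theorem realizes_lowerGen (k : Type u) [Field k] (hR : IsRookStrip β γ)
    (hw : β.card = γ.card + r) (Δ Γ : LRTableaux r β γ) {p b : ℕ}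
    (hL : IsLowering (rowWord γ Γ.1) p b) (hΔ : rowWord γ Δ.1 = lower (rowWord γ Γ.1) p b) :
    InCategory r β γ (nilpEmbedding
        (Submodule.span k[X] (Set.range (lowerGen k β γ (rowWord γ Γ.1) p b)))) ∧
      HasTableau (nilpEmbedding
        (Submodule.span k[X] (Set.range (lowerGen k β γ (rowWord γ Γ.1) p b)))) Δ := by
  classical
  have hs' : ∀ i, rowWord γ Δ.1 i ≠ 0 ↔ i ∈ stripRows β γ := rowWord_ne_zero_iff hR Δ
  rw [hΔ] at hs'
  have hs : ∀ i, rowWord γ Γ.1 i ≠ 0 ↔ i ∈ stripRows β γ := rowWord_ne_zero_iff hR Γ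
  set W := rowWord γ Γ.1 with hWdef
  have hW : IsLattice W := hL.lattice
  have hpos := hL.pos
  have hlt := hL.lt
  have hpS : p ∈ stripRows β γ := (hs p).1 (by omega)
  -- The lowered word is a lattice word with letter `b` in position `p`; this makes the truncated
  -- exponent `p + 1 - b` a true difference.
  have hbp : b ≤ p + 1 := by
    have := hL.lattice_lower.le_succ p
    rwa [lower_self] at this
  set q' := letterCount W b p with hq'
  have hqq : colIndex W p ≠ q' := hL.letterCount_lt_colIndex.ne'
  let a := lowerGen k β γ W p b
  have hmemA : ∀ s, a s ∈ Submodule.span k[X] (Set.range a) := fun s =>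
    Submodule.subset_span ⟨s, rfl⟩
  have hap : a (colIndex W p) = chainGen k β γ W (colIndex W p) := lowerGen_of_ne hqq
  have haq : ∀ l, (X ^ l : k[X]) • a q' = (X ^ l : k[X]) • chainGen k β γ W q' +
        (X ^ (p + 1 + l - b) : k[X]) • rowGen k β γ p := smul_lowerGen hbp
  -- Position `p` is now reached as the letter `b` of the chain `q'`. At the next `b` the term `X ^
  -- p • E_p` of that chain has to be cancelled by the chain of `p`, which costs divisibility: the
  -- difference lies only in `X ^ (W p - 1) • A`, as the lowered letter `W p` demands.
  let w : ℕ → NilpModule k β := fun i =>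
    if i = p then (X ^ (b - 1) : k[X]) • a q'
    else if IsNext W p b i then
      (X ^ (b - 1) : k[X]) • a q' - (X ^ (W p - 1) : k[X]) • a (colIndex W p)
    else (X ^ (W i - 1) : k[X]) • a (colIndex W i)
  have hwp : w p = (X ^ (b - 1) : k[X]) • a q' := by simp [w]
  have hwn : ∀ {j}, IsNext W p b j → w j =
      (X ^ (b - 1) : k[X]) • a q' - (X ^ (W p - 1) : k[X]) • a (colIndex W p) := by
    intro j hj
    simp [w, hj, hj.1.ne']
  have hwo : ∀ {i}, i ≠ p → ¬ IsNext W p b i →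
      w i = (X ^ (W i - 1) : k[X]) • a (colIndex W i) := by
    intro i h1 h2
    simp [w, h1, h2]
  have hwpE : w p = (X ^ (b - 1) : k[X]) • chainGen k β γ W q' +
      (X ^ p : k[X]) • rowGen k β γ p := by
    rw [hwp, haq, show p + 1 + (b - 1) - b = p by omega]
  refine realizes hR hw Δ a w (fun i hi => ?_) (fun i hi => ?_) fun l s => ?_
  · rw [hΔ]
    by_cases hip : i = p
    · subst hip
      rw [hwp, lower_self]
      exact Submodule.smul_mem_pointwise_smul _ _ _ (hmemA _)
    · by_cases hin : IsNext W p b i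
      · have h1 : w i = (X ^ (W p - 1) : k[X]) •
            ((X ^ (b - W p) : k[X]) • a q' - a (colIndex W p)) := by
          rw [hwn hin, smul_sub, ← mul_smul, ← pow_add,
            show W p - 1 + (b - W p) = b - 1 by omega]
        rw [h1, lower_next hin]
        exact Submodule.smul_mem_pointwise_smul _ _ _
          (Submodule.sub_mem _ (Submodule.smul_mem _ _ (hmemA _)) (hmemA _))
      · rw [hwo hip hin, lower_of_ne hip hin]
        exact Submodule.smul_mem_pointwise_smul _ _ _ (hmemA _)
  · by_cases hip : i = p
    · subst hip
      rw [hwpE, add_sub_cancel_right]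
      refine smul_chainGen_mem_tail hR hW fun i' hc hi' => ?_
      obtain ⟨j, h1, h2, h3⟩ := hW.exists_above (l := b) (by omega) (W i' - b) i' (by omega)
      have hj := (hL.isNext_iff (i := j)).2 ⟨h2, h3.trans hc⟩
      have := hj.1
      omega
    · by_cases hin : IsNext W p b i
      · have h1 : (X ^ (b - 1) : k[X]) • chainGen k β γ W q' - (X ^ i : k[X]) • rowGen k β γ i ∈
            tail k β γ i := by
          have := smul_chainGen_self_sub_mem_tail (k := k) hR hW hi
            (by rw [hin.2.1]; omega)
          rwa [hin.2.1, hin.colIndex] at this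
        have h2 : (X ^ (W p - 1) : k[X]) • chainGen k β γ W (colIndex W p) -
            (X ^ p : k[X]) • rowGen k β γ p ∈ tail k β γ i := by
          refine smul_chainGen_sub_mem_tail hR hW hpS (by omega) fun i' hc hi' => ?_
          -- The rest of the chain of `p` comes late enough to lie in the tail of the next `b`, not
          -- merely in that of `p`.
          obtain ⟨j, hj, hji⟩ := hL.exists_next hc (by omega)
          rw [hj.unique hin] at hji
          omega
        have h3 := Submodule.sub_mem _ h1 h2
        rw [hwn hin, ← hwp, hwpE, hap]
        convert h3 using 1
        abel
      · rw [hwo hip hin]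
        have h0 : 1 ≤ W i := Nat.one_le_iff_ne_zero.2 ((hs i).2 hi)
        have h1 := smul_chainGen_self_sub_mem_tail (k := k) hR hW hi h0
        by_cases hc : colIndex W i = q'
        · rw [hc] at h1
          rw [hc, haq, add_sub_right_comm]
          refine Submodule.add_mem _ h1 ?_
          -- The extra summand of the chain `q'` is harmless at its other letters: below `b` it lies
          -- in the tail, since `b - 1` occurs before `p`; above `b` it is already annihilated.
          have hWb : W i ≠ b := fun h => hin (hL.isNext_iff.2 ⟨h, hc⟩)
          rcases lt_or_gt_of_ne hWb with h | h
          · obtain ⟨i₁, h2, h3, h4⟩ := hL.exists_pred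
            have := hW.add_sub_le h0 (show W i ≤ W i₁ by omega) (hc.trans h4.symm)
            exact smul_rowGen_mem_tail (by omega) (by omega)
          · rw [smul_rowGen hR (by omega)]
            exact Submodule.zero_mem _
        · rw [show a (colIndex W i) = chainGen k β γ W (colIndex W i) from lowerGen_of_ne hc]
          exact h1
  · rw [hΔ]
    have hsub : ∀ i, l < lower W p b i → w i ∈ Submodule.span k
        (w '' {i | i ∈ stripRows β γ ∧ l < lower W p b i}) := fun i hi =>
      Submodule.subset_span ⟨i, ⟨(hs' i).1 (by omega), hi⟩, rfl⟩
    by_cases h : ∃ i, W i = l + 1 ∧ colIndex W i = s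
    · obtain ⟨i, hi, rfl⟩ := h
      by_cases hip : i = p
      · subst hip
        have hl : l = W i - 1 := by omega
        have h1 := hsub i (by rw [lower_self]; omega)
        by_cases hj : ∃ j, IsNext W i b j
        · obtain ⟨j, hj⟩ := hj
          have h2 := hsub j (by rw [lower_next hj]; omega)
          have h3 := Submodule.sub_mem _ h1 h2
          rw [hwn hj, ← hwp, sub_sub_cancel] at h3
          rwa [hl] at h3 ⊢
        · -- the chain of `p` ends in `p`, and the other chain ends before the letter `b`
          have h2 : (X ^ l : k[X]) • a (colIndex W i) = (X ^ i : k[X]) • rowGen k β γ i := by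
            rw [← sub_eq_zero, hap, smul_chainGen_sub hR hW hpS hi]
            refine Finset.sum_eq_zero fun i' hi' => ?_
            obtain ⟨-, h3, h4⟩ := Finset.mem_filter.1 hi'
            obtain ⟨j, h5, -⟩ := hL.exists_next h3 (by omega)
            exact absurd ⟨j, h5⟩ hj
          have h3 : (X ^ (b - 1) : k[X]) • chainGen k β γ W q' = 0 := by
            refine smul_chainGen_eq_zero hR hW fun i' hc => ?_
            by_contra! hi'
            obtain ⟨j, -, h5, h6⟩ := hW.exists_above (l := b) (by omega) (W i' - b) i' (by omega)
            exact hj ⟨j, hL.isNext_iff.2 ⟨h5, h6.trans hc⟩⟩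
          rw [hwpE, h3, zero_add, ← h2] at h1
          exact h1
      · by_cases hin : IsNext W p b i
        · have h1 := hsub p (by rw [lower_self]; have := hin.2.1; omega)
          rw [hin.colIndex]
          rwa [hwp, show b - 1 = l by have := hin.2.1; omega] at h1
        · have h1 := hsub i (by rw [lower_of_ne hip hin]; omega)
          rwa [hwo hip hin, hi] at h1
    · have hcol : ∀ i, colIndex W i = s → W i ≤ l := by
        intro i hi
        by_contra! hlt
        obtain ⟨i₀, -, h1, h2⟩ := hW.exists_above (l := l + 1) (by omega) (W i - (l + 1)) i
          (by omega)
        exact h ⟨i₀, h1, h2.trans hi⟩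
      have h0 := smul_chainGen_eq_zero (k := k) hR hW hcol
      by_cases hsq : s = q'
      · subst hsq
        -- The chain `q'` contains a letter `b - 1`, so it can only stop at `l ≥ b - 1`. For `l = b
        -- - 1` only the extra summand survives, and beyond that nothing does.
        obtain ⟨i₁, -, h3, h4⟩ := hL.exists_pred
        have h5 := hcol i₁ h4
        by_cases hl : l = b - 1
        · have h1 := hsub p (by rw [lower_self]; omega)
          rwa [hwp, ← hl] at h1
        · rw [haq, h0, smul_rowGen hR (by omega), add_zero]
          exact Submodule.zero_mem _
      · rw [show a s = chainGen k β γ W s from lowerGen_of_ne hsq, h0]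
        exact Submodule.zero_mem _

/-! ### Lowering moves are extensions -/

open Classical in
/-- The projection of `N_β` to the summands with index in `P`. -/
noncomputable def colProj (k : Type u) [Field k] (β : YoungDiagram) (P : ℕ → Prop) :
    NilpModule k β →ₗ[k[X]] NilpModule k β :=
  LinearMap.pi fun j => if P j then LinearMap.proj j else 0

theorem colProj_colProj (P : ℕ → Prop) (x : NilpModule k β) :
    colProj k β P (colProj k β P x) = colProj k β P x := by
  funext j
  simp only [colProj, LinearMap.pi_apply]
  split_ifs with h
  · simp [h]
  · simp

theorem colProj_colGen_of_mem {P : ℕ → Prop} {j : ℕ} (h : P j) :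
    colProj k β P (colGen k β j) = colGen k β j := by
  unfold colGen
  split_ifs with hj
  · funext j'
    simp only [colProj, LinearMap.pi_apply]
    split_ifs with h'
    · rfl
    · have : j' ≠ ⟨j, hj⟩ := by rintro rfl; exact h' h
      simp [this]
  · exact map_zero _

theorem colProj_colGen_of_notMem {P : ℕ → Prop} {j : ℕ} (h : ¬ P j) :
    colProj k β P (colGen k β j) = 0 := by
  unfold colGen
  split_ifs with hj
  · funext j'
    simp only [colProj, LinearMap.pi_apply]
    split_ifs with h'
    · have : j' ≠ ⟨j, hj⟩ := by rintro rfl; exact h h'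
      simp [this]
    · rfl
  · exact map_zero _

theorem span_range_eq_sup {M : Type*} [AddCommGroup M] [Module k[X] M] (a : ℕ → M) (q : ℕ) :
    Submodule.span k[X] (Set.range a) =
      Submodule.span k[X] (a '' {s | s ≠ q}) ⊔ Submodule.span k[X] {a q} := by
  rw [← Submodule.span_union]
  congr 1
  ext x
  constructor
  · rintro ⟨s, rfl⟩
    by_cases h : s = q
    · exact Or.inr (by rw [h]; rfl)
    · exact Or.inl ⟨s, h, rfl⟩
  · rintro (⟨s, -, rfl⟩ | rfl)
    · exact ⟨s, rfl⟩
    · exact ⟨q, rfl⟩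

/-- The chains use disjoint sets of columns and `p` is not in the chain `q'`. So the projection to
the columns of that chain fixes its generator, kills all other generators and kills the extra
summand, as `extLE_of_idempotent` requires. -/
theorem LowerMove.exists_extLE (k : Type u) [Field k] (hR : IsRookStrip β γ)
    (hw : β.card = γ.card + r) {Δ Γ : LRTableaux r β γ} (h : LowerMove Δ Γ) :
    ∃ Y Z : Embedding k, InCategory r β γ Y ∧ InCategory r β γ Z ∧
      HasTableau Y Δ ∧ HasTableau Z Γ ∧ Y.ExtLE Z := by
  obtain ⟨p, b, hL, hΔ⟩ := h
  obtain ⟨hY, hYt⟩ := realizes_lowerGen k hR hw Δ Γ hL hΔ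
  obtain ⟨hZ, hZt⟩ := realizes_chainGen k hR hw Γ
  refine ⟨_, _, hY, hZ, hYt, hZt, ?_⟩
  have hfin : ∀ A : Submodule k[X] (NilpModule k β),
      InCategory r β γ (nilpEmbedding A) → Module.finrank k A = r := by
    rintro A ⟨-, -, α, hα, ⟨φ⟩⟩
    have := (φ.restrictScalars k).finrank_eq
    rw [finrank_nilpModule, hα] at this
    exact this
  have hdim := (hfin _ hY).le.trans (hfin _ hZ).ge
  set W := rowWord γ Γ.1
  set q' := letterCount W b p with hq'
  have hpS : p ∈ stripRows β γ := (rowWord_ne_zero_iff hR Γ p).1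
    (Nat.one_le_iff_ne_zero.1 hL.pos)
  have himg : lowerGen k β γ W p b '' {s | s ≠ q'} = chainGen k β γ W '' {s | s ≠ q'} :=
    Set.image_congr fun s hs => lowerGen_of_ne hs
  rw [span_range_eq_sup _ q', span_range_eq_sup (chainGen k β γ W) q', himg] at hdim ⊢
  let P : ℕ → Prop := fun j => ∃ i ∈ stripRows β γ, γ.rowLen i = j ∧ colIndex W i = q'
  have hP : ∀ i ∈ stripRows β γ, P (γ.rowLen i) ↔ colIndex W i = q' := by
    intro i hi
    constructor
    · rintro ⟨i', hi', h1, h2⟩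
      rwa [rowLen_injOn hR hi hi' h1.symm]
    · exact fun h => ⟨i, hi, rfl, h⟩
  have hrow : ∀ i ∈ stripRows β γ, colIndex W i = q' →
      colProj k β P (rowGen k β γ i) = rowGen k β γ i := by
    intro i hi h
    rw [rowGen, if_pos hi, colProj_colGen_of_mem ((hP i hi).2 h)]
  have hrow' : ∀ i ∈ stripRows β γ, colIndex W i ≠ q' →
      colProj k β P (rowGen k β γ i) = 0 := by
    intro i hi h
    rw [rowGen, if_pos hi, colProj_colGen_of_notMem fun h' => h ((hP i hi).1 h')]
  have hchain : colProj k β P (chainGen k β γ W q') = chainGen k β γ W q' := by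
    rw [chainGen, map_sum]
    refine Finset.sum_congr rfl fun i hi => ?_
    obtain ⟨h1, h2⟩ := Finset.mem_filter.1 hi
    rw [map_smul, hrow i h1 h2]
  have hchain' : ∀ s, s ≠ q' → colProj k β P (chainGen k β γ W s) = 0 := by
    intro s hs
    rw [chainGen, map_sum]
    refine Finset.sum_eq_zero fun i hi => ?_
    obtain ⟨h1, h2⟩ := Finset.mem_filter.1 hi
    rw [map_smul, hrow' i h1 (by rw [h2]; exact hs), smul_zero]
  refine extLE_of_idempotent (ambient k β) (colProj k β P) (colProj_colProj P) _ _ _ ?_ hchain ?_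
    hdim
  · intro x hx
    have hle : Submodule.span k[X] (chainGen k β γ W '' {s | s ≠ q'}) ≤
        LinearMap.ker (colProj k β P) := by
      rw [Submodule.span_le]
      rintro _ ⟨s, hs, rfl⟩
      exact hchain' s hs
    exact hle hx
  · have h1 : lowerGen k β γ W p b q' = chainGen k β γ W q' +
        (X ^ (p + 1 - b) : k[X]) • rowGen k β γ p := by
      rw [lowerGen, if_pos rfl]
    have h2 : colProj k β P (lowerGen k β γ W p b q') = chainGen k β γ W q' := by
      rw [h1, map_add, hchain, map_smul, hrow' p hpS hL.letterCount_lt_colIndex.ne', smul_zero,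
        add_zero]
    exact h2

end Chains

end LRInv

/-! ### Assembly: every order implies dominance, and dominance gives chains of lowering moves. -/

theorem mainTheorem2 (k : Type u) [Field k] (r : ℕ) (hr : 1 ≤ r) (β γ : YoungDiagram)
    (hrook : LRInv.IsRookStrip β γ) (hweight : β.card = γ.card + r)
    (Δ Γ : LRInv.LRTableaux r β γ) :
    (LRInv.BoxLE Δ Γ ↔ LRInv.ExtLE k Δ Γ) ∧
    (LRInv.ExtLE k Δ Γ ↔ LRInv.HomLE k Δ Γ) ∧
    (LRInv.HomLE k Δ Γ ↔ LRInv.DomLE Δ Γ) := by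
  have hbox : LRInv.DomLE Δ Γ → LRInv.BoxLE Δ Γ := fun h =>
    Relation.ReflTransGen.mono (fun _ _ h => h.boxMove hrook) _ _
      (h.reflTransGen_lowerMove hrook hweight)
  have hext : LRInv.DomLE Δ Γ → LRInv.ExtLE k Δ Γ := fun h =>
    Relation.ReflTransGen.mono (fun _ _ h => h.exists_extLE k hrook hweight) _ _
      (h.reflTransGen_lowerMove hrook hweight)
  exact ⟨⟨fun h => hext (h.domLE hrook hweight), fun h => hbox h.homLE.domLE⟩,
    ⟨fun h => h.homLE, fun h => hext h.domLE⟩, ⟨fun h => h.domLE, fun h => (hext h).homLE⟩⟩
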